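/- Let $M$ be a closed connected orientable topological $n$-manifold, $n\ge 1$, with fundamental class $[M]\in H_n(M;\mathbb R)$ (for either orientation), and let $\mathcal F$ be a (topological) codimension one foliation of $M$. Call a singular simplex $\sigma:\Delta^n\to M$ transverse to $\mathcal F$ if the foliation of $\Delta^n$ induced by pulling back $\mathcal F$ along $\sigma$ is topologically conjugate, by a homeomorphism of $\Delta^n$, to an affine foliation, i.e. to the foliation of $\Delta^n$ by the point preimages of some (possibly degenerate) affine map $\Delta^n\to\mathbb R$; here the induced foliation is the one given locally by the fibres of $f\circ\sigma$, for $f$ the transverse coordinate of a foliated chart of $\mathcal F$. Let $$\|[M]\|_G=\inf\Big\{\sum_i|r_i| : \sum_i r_i\sigma_i \text{ a real singular cycle representing } [M]\Big\}$$ be the Gromov norm, and let $$\|([M],\mathcal F)\|_{FG}=\inf\Big\{\sum_i|r_i| : \sum_i r_i\sigma_i \text{ a real singular cycle representing } [M],\ \text{all } \sigma_i \text{ transverse to } \mathcal F\Big\}$$ be the foliated Gromov norm ($+\infty$ if there is no such cycle). Suppose that the foliation $\widetilde{\mathcal F}$ of the universal cover $\widetilde M$ of $M$ induced by $\mathcal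 F$ is topologically conjugate to the standard foliation of $\mathbb R^n=\mathbb R^{n-1}\times\mathbb R$ by the horizontal hyperplanes $\mathbb R^{n-1}\times\{s\}$. Then $$\|[M]\|_G=\|([M],\mathcal F)\|_{FG}.$$ -/

import Mathlib

open Topology
open scoped ENNReal

noncomputable section

namespace FoliatedGromov

universe u v

/-! ### Singular chains and singular homology -/

/-- The standard affine `n`-simplex. -/
abbrev Simplex (n : ℕ) : Type := stdSimplex ℝ (Fin (n + 1))

/-- Singular `n`-chains in `X` with coefficients in `R`: finite formal `R`-linear combinations of
singular `n`-simplices `σ : Δⁿ → X`. -/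
abbrev Chain (R : Type) [CommRing R] (n : ℕ) (X : Type u) [TopologicalSpace X] : Type u :=
  C(Simplex n, X) →₀ R

/-- The `i`-th face inclusion `Δⁿ → Δⁿ⁺¹`, onto the face opposite to the `i`-th vertex. -/
def faceInclusion (n : ℕ) (i : Fin (n + 2)) : C(Simplex n, Simplex (n + 1)) :=
  ⟨stdSimplex.map i.succAbove, stdSimplex.continuous_map _⟩

/-- The singular boundary operator, `∂σ = ∑ᵢ (-1)ⁱ σ ∘ δᵢ`. -/
def boundary (R : Type) [CommRing R] (n : ℕ) (X : Type u) [TopologicalSpace X] :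
    Chain R (n + 1) X →ₗ[R] Chain R n X :=
  ∑ i : Fin (n + 2), ((-1 : R) ^ (i : ℕ)) •
    Finsupp.lmapDomain R R (fun σ : C(Simplex (n + 1), X) => σ.comp (faceInclusion n i))

/-- The singular cycles of degree `n + 1`. -/
abbrev Cycles (R : Type) [CommRing R] (n : ℕ) (X : Type u) [TopologicalSpace X] :
    Submodule R (Chain R (n + 1) X) :=
  LinearMap.ker (boundary R n X)

/-- The singular boundaries of degree `n + 1`. -/
abbrev Boundaries (R : Type) [CommRing R] (n : ℕ) (X : Type u) [TopologicalSpace X] :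
    Submodule R (Chain R (n + 1) X) :=
  LinearMap.range (boundary R (n + 1) X)

/-- The singular homology `H_{n+1}(X; R)`: cycles of degree `n + 1` modulo boundaries, realized as
the image of the cycles in the quotient of all chains by the boundaries. -/
abbrev Homology (R : Type) [CommRing R] (n : ℕ) (X : Type u) [TopologicalSpace X] :
    Submodule R (Chain R (n + 1) X ⧸ Boundaries R n X) :=
  (Cycles R n X).map (Boundaries R n X).mkQ

/-- The homology class of a cycle of degree `n + 1`. -/
def homologyClass {R : Type} [CommRing R] {n : ℕ} {X : Type u} [TopologicalSpace X]
    (c : Cycles R n X) : Homology R n X :=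
  ⟨(Boundaries R n X).mkQ c, Submodule.mem_map_of_mem c.2⟩

/-! ### Fundamental classes -/

/-- The chains supported on singular simplices with image in `A`. -/
def chainsIn (R : Type) [CommRing R] (n : ℕ) {X : Type u} [TopologicalSpace X] (A : Set X) :
    Submodule R (Chain R n X) :=
  Finsupp.supported R R {σ : C(Simplex n, X) | Set.range σ ⊆ A}

/-- The class of the integral cycle `z` generates the local homology group
`H_{n+1}(X, X ∖ {x}; ℤ)`: every relative cycle is homologous, relative to `X ∖ {x}`, to an
integer multiple of `z`. -/
def GeneratesLocalHomology {n : ℕ} {X : Type u} [TopologicalSpace X]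
    (z : Chain ℤ (n + 1) X) (x : X) : Prop :=
  ∀ c : Chain ℤ (n + 1) X, boundary ℤ n X c ∈ chainsIn ℤ n ({x}ᶜ : Set X) →
    ∃ (m : ℤ) (b : Chain ℤ (n + 2) X),
      c - m • z - boundary ℤ (n + 1) X b ∈ chainsIn ℤ (n + 1) ({x}ᶜ : Set X)

/-- The real chain with the same (integral) coefficients. -/
def toRealChain {n : ℕ} {X : Type u} [TopologicalSpace X] (z : Chain ℤ n X) : Chain ℝ n X :=
  Finsupp.mapRange (fun m : ℤ => (m : ℝ)) Int.cast_zero z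

/-- `μ ∈ H_{n+1}(M; ℝ)` is the fundamental class `[M]` of the closed `(n+1)`-manifold `M` for
one of its orientations: it is the real class of an integral cycle whose class generates
`H_{n+1}(M, M ∖ {x}; ℤ)` for every `x`. Such a class exists if and only if `M` is orientable. -/
def IsFundamentalClass {n : ℕ} {M : Type u} [TopologicalSpace M] (μ : Homology ℝ n M) : Prop :=
  ∃ z : Cycles ℤ n M, (∀ x : M, GeneratesLocalHomology (z : Chain ℤ (n + 1) M) x) ∧
    ∃ c : Cycles ℝ n M, (c : Chain ℝ (n + 1) M) = toRealChain (z : Chain ℤ (n + 1) M) ∧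
      homologyClass c = μ

/-! ### Codimension one foliations -/

/-- Near `x`, the functions `g` and `h` have the same fibres. (The condition passes to smaller
neighbourhoods, so only the germs of `g` and `h` at `x` matter.) -/
def SameFibersNear {X : Type u} [TopologicalSpace X] {A B : Type*} (g : X → A) (h : X → B)
    (x : X) : Prop :=
  ∃ U ∈ 𝓝 x, ∀ y ∈ U, ∀ z ∈ U, g y = g z ↔ h y = h z

/-- A (topological) codimension one foliation, with leaves of dimension `k`, of a manifold `M` of
dimension `k + 1`: an atlas of charts to `ℝᵏ × ℝ` such that the coordinate changes locally take
plaques `ℝᵏ × {s}` to plaques, that is, are locally of the form `(x, s) ↦ (g (x, s), h s)`. -/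
structure Foliation (k : ℕ) (M : Type u) [TopologicalSpace M] where
  charts : Set (OpenPartialHomeomorph M (EuclideanSpace ℝ (Fin k) × ℝ))
  cover : ∀ x : M, ∃ e ∈ charts, x ∈ e.source
  compatible : ∀ e ∈ charts, ∀ e' ∈ charts, ∀ x ∈ e.source, x ∈ e'.source →
    SameFibersNear (fun y => (e y).2) (fun y => (e' y).2) x

/-- The standard foliation of `ℝᵏ × ℝ` by the horizontal `ℝᵏ × {s}`. -/
def Foliation.horizontal (k : ℕ) : Foliation k (EuclideanSpace ℝ (Fin k) × ℝ) where
  charts := {OpenPartialHomeomorph.refl _}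
  cover := fun _ => ⟨_, rfl, Set.mem_univ _⟩
  compatible := by
    rintro e rfl e' rfl x - -
    exact ⟨Set.univ, Filter.univ_mem, fun _ _ _ _ => Iff.rfl⟩

/-- The foliation induced on `N` by a local homeomorphism `p : N → M`; its charts are the
composites of local restrictions of `p` with charts of the foliation of `M`. -/
def Foliation.pullback {k : ℕ} {M : Type u} {N : Type v} [TopologicalSpace M]
    [TopologicalSpace N] (F : Foliation k M) {p : N → M} (hp : IsLocalHomeomorph p) :
    Foliation k N where
  charts := {f | ∃ e ∈ F.charts, ∃ s : OpenPartialHomeomorph N M,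
    Set.EqOn p s s.source ∧ f = s.trans e}
  cover := by
    intro y
    obtain ⟨s, hy, hs⟩ := hp y
    obtain ⟨e, he, hye⟩ := F.cover (p y)
    refine ⟨s.trans e, ⟨e, he, s, fun _ _ => by rw [hs], rfl⟩, ?_⟩
    rw [OpenPartialHomeomorph.trans_source]
    exact ⟨hy, by rw [Set.mem_preimage, ← hs]; exact hye⟩
  compatible := by
    rintro f ⟨e, he, s, hs, rfl⟩ f' ⟨e', he', s', hs', rfl⟩ y hy hy'
    rw [OpenPartialHomeomorph.trans_source] at hy hy'
    have h1 : p y ∈ e.source := by rw [hs hy.1]; exact hy.2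
    have h2 : p y ∈ e'.source := by rw [hs' hy'.1]; exact hy'.2
    obtain ⟨U, hU, h⟩ := F.compatible e he e' he' (p y) h1 h2
    refine ⟨(p ⁻¹' U ∩ s.source) ∩ s'.source, Filter.inter_mem (Filter.inter_mem
      (hp.continuous.continuousAt hU) (s.open_source.mem_nhds hy.1))
      (s'.open_source.mem_nhds hy'.1), ?_⟩
    intro a ha b hb
    have := h (p a) ha.1.1 (p b) hb.1.1
    simp only [OpenPartialHomeomorph.coe_trans, Function.comp_apply]
    rw [← hs ha.1.2, ← hs hb.1.2, ← hs' ha.2, ← hs' hb.2]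
    exact this

/-- Two foliations are topologically conjugate if some homeomorphism takes the one to the other,
i.e. takes plaques to plaques locally. -/
def Foliation.Conjugate {k : ℕ} {M : Type u} {N : Type v} [TopologicalSpace M]
    [TopologicalSpace N] (F : Foliation k M) (G : Foliation k N) : Prop :=
  ∃ Φ : M ≃ₜ N, ∀ x : M, ∀ e ∈ F.charts, ∀ e' ∈ G.charts, x ∈ e.source → Φ x ∈ e'.source →
    SameFibersNear (fun y => (e y).2) (fun y => (e' (Φ y)).2) x

/-- A singular simplex `σ : Δⁿ → M` is transverse to `F` if the foliation of `Δⁿ` induced by `σ`,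
which is given near `t` by the fibres of the transverse coordinate of a chart around `σ t`
composed with `σ`, is topologically conjugate, by some homeomorphism `φ` of `Δⁿ`, to the affine
foliation of `Δⁿ` by the fibres of some (possibly degenerate) affine map `a : Δⁿ → ℝ`. -/
def Foliation.IsTransverse {k : ℕ} {M : Type u} [TopologicalSpace M] (F : Foliation k M) {n : ℕ}
    (σ : C(Simplex n, M)) : Prop :=
  ∃ (φ : Simplex n ≃ₜ Simplex n) (a : (Fin (n + 1) → ℝ) →ᵃ[ℝ] ℝ),
    ∀ t : Simplex n, ∀ e ∈ F.charts, σ t ∈ e.source →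
      SameFibersNear (fun s => (e (σ s)).2) (fun s => a (φ s : Fin (n + 1) → ℝ)) t

/-! ### Gromov norms -/

/-- The `L¹` norm `∑ |rᵢ|` of a real singular chain `∑ rᵢ σᵢ`. -/
def l1Norm {n : ℕ} {X : Type u} [TopologicalSpace X] (c : Chain ℝ n X) : ℝ :=
  c.sum fun _ r => |r|

/-- The Gromov norm of a real homology class: the infimum of the `L¹` norms of the singular cycles
that represent it. -/
def gromovNorm {n : ℕ} {X : Type u} [TopologicalSpace X] (μ : Homology ℝ n X) : ℝ≥0∞ :=
  ⨅ (c : Cycles ℝ n X) (_ : homologyClass c = μ), ENNReal.ofReal (l1Norm (c : Chain ℝ (n + 1) X))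

/-- The foliated Gromov norm of a real homology class: the infimum of the `L¹` norms of the
singular cycles that represent it and all of whose singular simplices are transverse to `F`
(it is `∞` if there are no such cycles). -/
def foliatedGromovNorm {k : ℕ} {M : Type u} [TopologicalSpace M] (F : Foliation k M) {n : ℕ}
    (μ : Homology ℝ n M) : ℝ≥0∞ :=
  ⨅ (c : Cycles ℝ n M) (_ : homologyClass c = μ)
    (_ : ∀ σ ∈ (c : Chain ℝ (n + 1) M).support, F.IsTransverse σ),
    ENNReal.ofReal (l1Norm (c : Chain ℝ (n + 1) M))

end FoliatedGromov

end

namespace FoliatedGromov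

universe u v

/-! ### The prism operator -/

/-! Transverse cycles are cycles, so only the bound of the foliated norm by the Gromov norm needs an
argument. It is a straightening: every cycle is replaced by a homologous one of no larger norm whose
simplices are transverse.

The conjugacy identifies the cover with `ℝᵏ × ℝ`, and the deck transformations permute the
horizontal slices, so they act on the heights by homeomorphisms of `ℝ`, possibly decreasing ones.
Points of the cover are labelled equivariantly by deck transformations, and a straight simplex
depends only on the labels `g i` of the vertices. Let `w i` be the strictly decreasing function of
height, vanishing at the translate by `g i` of a base height `s₀`, that is transported from `s₀ - t`
by the deck action, up to sign. The point with barycentric coordinates `x` is put at the height `f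
x` where `∑ x i * w i` vanishes. This recipe commutes with deck transformations and with faces. The
position inside the slice comes from successive contractions of slices towards translated centres,
which is possible because the slices are copies of `ℝᵏ`.

Transversality (`exists_homeomorph_affine`) holds because `w i t = c i t * (θ (s i) - θ t)`, where
`s i` is the zero of `w i`, `θ` is a single increasing function and every `c i` is positive and
continuous. Rescaling barycentric coordinates by `c i (f x)` then makes the level sets affine. Such
a `θ` is built when functions `w i` with the same zero have the same germ there; a Baire argument
supplies an `s₀` that ensures this.

Straightening preserves homology classes because a simplex and its straightening can both be
contracted, naturally and equivariantly, to the same simplex, which depends only on the vertex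
labels; the prism operator turns the two homotopies into homologies. The norm does not grow since
each simplex is replaced by one simplex. -/

theorem faceInclusion_succAbove {n : ℕ} (i : Fin (n + 2)) (x : Simplex n) (j : Fin (n + 1)) :
    faceInclusion n i x (i.succAbove j) = x j := by
  change FunOnFinite.linearMap ℝ ℝ i.succAbove x (i.succAbove j) = _
  rw [FunOnFinite.linearMap_apply_apply, Finset.sum_eq_single j]
  · intro b hb hbj
    simp only [Finset.mem_filter, Finset.mem_univ, true_and] at hb
    exact absurd (Fin.succAbove_right_injective hb) hbj
  · simp

theorem faceInclusion_self {n : ℕ} (i : Fin (n + 2)) (x : Simplex n) :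
    faceInclusion n i x i = 0 := by
  change FunOnFinite.linearMap ℝ ℝ i.succAbove x i = _
  rw [FunOnFinite.linearMap_apply_apply]
  refine Finset.sum_eq_zero fun b hb => ?_
  simp only [Finset.mem_filter, Finset.mem_univ, true_and] at hb
  exact absurd hb (Fin.succAbove_ne i b)

theorem val_succAbove {n : ℕ} (p : Fin (n + 1)) (i : Fin n) :
    (p.succAbove i : ℕ) = if (i : ℕ) < p then (i : ℕ) else i + 1 := by
  simp only [Fin.succAbove, Fin.lt_def, Fin.val_castSucc]
  split_ifs <;> simp

theorem val_predAbove {n : ℕ} (p : Fin n) (i : Fin (n + 1)) :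
    (p.predAbove i : ℕ) = if (p : ℕ) < i then (i : ℕ) - 1 else i := by
  simp only [Fin.predAbove, Fin.lt_def, Fin.val_castSucc]
  split_ifs <;> simp

/-- The affine map `Δᵐ → Δⁿ × ℝ` that is `φ` on vertices, the vertices satisfying `P` being sent to
height `1` and the others to height `0`. -/
noncomputable def prismMap {m n : ℕ} (φ : Fin (m + 1) → Fin (n + 1)) (P : Fin (m + 1) → Prop)
    [DecidablePred P] : C(Simplex m, Simplex n × ℝ) where
  toFun x := (stdSimplex.map φ x, ∑ l, if P l then x l else 0)
  continuous_toFun := by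
    refine (stdSimplex.continuous_map _).prodMk (continuous_finsetSum _ fun l _ => ?_)
    split_ifs
    · exact (continuous_apply l).comp continuous_subtype_val
    · exact continuous_const

theorem prismMap_comp_faceInclusion {m n : ℕ} (φ : Fin (m + 2) → Fin (n + 1))
    (P : Fin (m + 2) → Prop) [DecidablePred P] (i : Fin (m + 2)) :
    (prismMap φ P).comp (faceInclusion m i) =
      prismMap (φ ∘ i.succAbove) (fun l => P (i.succAbove l)) := by
  ext1 x
  refine Prod.ext ?_ ?_
  · exact stdSimplex.map_comp_apply _ _ _
  · change (∑ l, if P l then faceInclusion m i x l else 0) =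
      ∑ l, if P (i.succAbove l) then x l else 0
    rw [Fin.sum_univ_succAbove _ i, faceInclusion_self, ite_self, zero_add]
    simp only [faceInclusion_succAbove]

theorem faceInclusion_prodMap_comp_prismMap {m n : ℕ} (φ : Fin (m + 1) → Fin (n + 1))
    (P : Fin (m + 1) → Prop) [DecidablePred P] (i : Fin (n + 2)) :
    ((faceInclusion n i).prodMap (ContinuousMap.id ℝ)).comp (prismMap φ P) =
      prismMap (i.succAbove ∘ φ) P := by
  ext1 x
  exact Prod.ext (stdSimplex.map_comp_apply _ _ _) rfl

theorem prismMap_congr {m n : ℕ} {φ φ' : Fin (m + 1) → Fin (n + 1)} {P P' : Fin (m + 1) → Prop}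
    [DecidablePred P] [DecidablePred P'] (h : ∀ l, φ l = φ' l) (h' : ∀ l, P l ↔ P' l) :
    prismMap φ P = prismMap φ' P' := by
  obtain rfl : φ = φ' := funext h
  obtain rfl : P = P' := funext fun l => propext (h' l)
  congr

/-- The sign bookkeeping of the prism formula: `T j i` stands for face `j` of the `i`-th prism
simplex, `U j i` for the `i`-th prism simplex over face `j`. The faces `j = i` and `j = i + 1` are
the interior walls `β`, which telescope; all other faces cancel against `U`. -/
theorem alternating_sum_prism {G : Type*} [AddCommGroup G] [Module ℝ G] {n : ℕ}
    (T : Fin (n + 3) → Fin (n + 2) → G) (U : Fin (n + 2) → Fin (n + 1) → G) (β : Fin (n + 3) → G)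
    (h₁ : ∀ i, T i.castSucc i = β i.castSucc) (h₂ : ∀ i, T i.succ i = β i.succ)
    (h₃ : ∀ j i, j ≤ i.castSucc → T j.castSucc i.succ = U j i)
    (h₄ : ∀ j i, i.castSucc < j → T j.succ i.castSucc = U j i) :
    ∑ j : Fin (n + 3), ∑ i : Fin (n + 2), (-1 : ℝ) ^ ((j : ℕ) + (i : ℕ)) • T j i +
      ∑ j : Fin (n + 2), ∑ i : Fin (n + 1), (-1 : ℝ) ^ ((j : ℕ) + (i : ℕ)) • U j i =
        β 0 - β (Fin.last _) := by
  -- For fixed `i`, the double `succAbove` enumerates the faces other than `i` and `i + 1`. The map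
  -- sending `(i, j)` to `(i.succAbove j, j.predAbove i)` is the simplicial identity that exchanges
  -- the order of the two indices.
  have key : ∑ p : Fin (n + 2) × Fin (n + 1),
      (-1 : ℝ) ^ ((p.1.castSucc.succAbove (p.1.succAbove p.2) : Fin (n + 3)) + (p.1 : ℕ)) •
        T (p.1.castSucc.succAbove (p.1.succAbove p.2)) p.1 =
      ∑ p : Fin (n + 2) × Fin (n + 1), -((-1 : ℝ) ^ ((p.1 : ℕ) + (p.2 : ℕ)) • U p.1 p.2) := by
    refine Finset.sum_nbij' (fun p => (p.1.succAbove p.2, p.2.predAbove p.1))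
      (fun p => (p.1.succAbove p.2, p.2.predAbove p.1)) (by simp) (by simp) ?_ ?_ ?_
    · rintro ⟨i, j⟩ -
      simp [Fin.succAbove_succAbove_predAbove, Fin.predAbove_predAbove_succAbove]
    · rintro ⟨i, j⟩ -
      simp [Fin.succAbove_succAbove_predAbove, Fin.predAbove_predAbove_succAbove]
    · rintro ⟨i, j⟩ -
      dsimp only
      rcases lt_or_ge j.castSucc i with h | h
      · obtain ⟨i, rfl⟩ : ∃ i' : Fin (n + 1), i = i'.succ :=
          Fin.exists_succ_eq.2 (Fin.ne_zero_of_lt h) |>.imp fun _ h => h.symm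
        have hj : j ≤ i := by
          rw [Fin.lt_def] at h; rw [Fin.le_def]; simp at h; omega
        have e₁ : i.succ.succAbove j = j.castSucc := Fin.succAbove_of_castSucc_lt _ _ h
        have e₂ : j.predAbove i.succ = i := Fin.predAbove_of_castSucc_lt _ _ h
        have e₃ : i.succ.castSucc.succAbove j.castSucc = j.castSucc.castSucc :=
          Fin.succAbove_of_castSucc_lt _ _ (by simpa using h)
        rw [e₁, e₂, e₃, h₃ _ _ (by simpa using hj), ← neg_smul]
        congr 1
        simp only [Fin.val_castSucc, Fin.val_succ]
        ring
      · obtain ⟨i, rfl⟩ : ∃ i' : Fin (n + 1), i = i'.castSucc :=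
          ⟨i.castPred (ne_of_lt (h.trans_lt (Fin.castSucc_lt_last j))), by simp⟩
        have hj : i ≤ j := by simpa using h
        have e₁ : i.castSucc.succAbove j = j.succ := Fin.succAbove_of_le_castSucc _ _ h
        have e₂ : j.predAbove i.castSucc = i := Fin.predAbove_of_le_castSucc _ _ h
        have e₃ : i.castSucc.castSucc.succAbove j.succ = j.succ.succ :=
          Fin.succAbove_of_le_castSucc _ _ (by
            rw [Fin.le_def] at *; simp at *; omega)
        rw [e₁, e₂, e₃, h₄ _ _ (by rw [Fin.le_def] at hj; rw [Fin.lt_def]; simp; omega), ← neg_smul]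
        congr 1
        simp only [Fin.val_castSucc, Fin.val_succ]
        ring
  have hT : ∀ i : Fin (n + 2), ∑ j : Fin (n + 3), (-1 : ℝ) ^ ((j : ℕ) + (i : ℕ)) • T j i =
      β i.castSucc - β i.succ + ∑ j : Fin (n + 1),
        (-1 : ℝ) ^ ((i.castSucc.succAbove (i.succAbove j) : Fin (n + 3)) + (i : ℕ)) •
        T (i.castSucc.succAbove (i.succAbove j)) i := by
    intro i
    rw [Fin.sum_univ_succAbove _ i.castSucc, Fin.sum_univ_succAbove _ i,
      Fin.succAbove_castSucc_self, h₁, h₂, ← add_assoc, sub_eq_add_neg, ← neg_one_smul ℝ (β i.succ)]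
    congr 3
    · simp [← two_mul]
    · rw [Fin.val_succ, show (i : ℕ) + 1 + i = 2 * i + 1 by ring, pow_succ, pow_mul]
      simp
  rw [Finset.sum_comm, Finset.sum_congr rfl fun i _ => hT i, Finset.sum_add_distrib,
    ← Fintype.sum_prod_type', key, Finset.sum_neg_distrib,
    ← Fintype.sum_prod_type' (f := fun (j : Fin (n + 2)) (i : Fin (n + 1)) =>
      (-1 : ℝ) ^ ((j : ℕ) + (i : ℕ)) • U j i),
    neg_add_cancel_right, Finset.sum_sub_distrib]
  rw [eq_sub_iff_add_eq, sub_add_eq_add_sub, ← Fin.sum_univ_castSucc β, Fin.sum_univ_succ β,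
    add_sub_cancel_right]

section Prism

variable {X : Type u} [TopologicalSpace X]
  (H : ∀ n, C(Simplex n, X) → C(Simplex n × ℝ, X))

/-- The prism operator of a homotopy of singular simplices. -/
noncomputable def prism (n : ℕ) : Chain ℝ n X →ₗ[ℝ] Chain ℝ (n + 1) X :=
  ∑ i : Fin (n + 1), ((-1 : ℝ) ^ (i : ℕ)) • Finsupp.lmapDomain ℝ ℝ
    (fun σ => (H n σ).comp (prismMap i.predAbove (fun l => i.castSucc < l)))

/-- The map of chains given by evaluating a homotopy of singular simplices at time `s`. -/
noncomputable def homotopyEnd (s : ℝ) (n : ℕ) (σ : C(Simplex n, X)) : C(Simplex n, X) :=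
  (H n σ).comp ((ContinuousMap.id _).prodMk (ContinuousMap.const _ s))

theorem boundary_single {n : ℕ} (σ : C(Simplex (n + 1), X)) (r : ℝ) :
    boundary ℝ n X (Finsupp.single σ r) =
      ∑ i : Fin (n + 2), Finsupp.single (σ.comp (faceInclusion n i)) ((-1) ^ (i : ℕ) * r) := by
  simp only [boundary, LinearMap.sum_apply, LinearMap.smul_apply, Finsupp.lmapDomain_apply,
    Finsupp.mapDomain_single, Finsupp.smul_single, smul_eq_mul]

theorem prism_single {n : ℕ} (σ : C(Simplex n, X)) (r : ℝ) :
    prism H n (Finsupp.single σ r) = ∑ i : Fin (n + 1), Finsupp.single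
      ((H n σ).comp (prismMap i.predAbove (fun l => i.castSucc < l))) ((-1) ^ (i : ℕ) * r) := by
  simp only [prism, LinearMap.sum_apply, LinearMap.smul_apply, Finsupp.lmapDomain_apply,
    Finsupp.mapDomain_single, Finsupp.smul_single, smul_eq_mul]

theorem boundary_prism
    (hH : ∀ n (i : Fin (n + 2)) (σ : C(Simplex (n + 1), X)), H n (σ.comp (faceInclusion n i)) =
      (H (n + 1) σ).comp ((faceInclusion n i).prodMap (ContinuousMap.id ℝ))) (n : ℕ) :
    boundary ℝ (n + 1) X ∘ₗ prism H (n + 1) + prism H n ∘ₗ boundary ℝ n X =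
      Finsupp.lmapDomain ℝ ℝ (homotopyEnd H 1 (n + 1)) -
        Finsupp.lmapDomain ℝ ℝ (homotopyEnd H 0 (n + 1)) := by
  -- `β m` is the wall of the prism whose vertices from index `m` on are raised to height `1`: `m =
  -- 0` gives the top of the prism and the last index gives its bottom.
  let β : Fin (n + 3) → (Chain ℝ (n + 1) X →ₗ[ℝ] Chain ℝ (n + 1) X) := fun m =>
    Finsupp.lmapDomain ℝ ℝ
      (fun σ => (H (n + 1) σ).comp (prismMap id (fun l => m ≤ l.castSucc)))
  have h := alternating_sum_prism (n := n)
    (fun j i => Finsupp.lmapDomain ℝ ℝ (fun σ => ((H (n + 1) σ).comp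
      (prismMap i.predAbove (fun l => i.castSucc < l))).comp (faceInclusion (n + 1) j)))
    (fun j i => Finsupp.lmapDomain ℝ ℝ (fun σ => (H n (σ.comp (faceInclusion n j))).comp
      (prismMap i.predAbove (fun l => i.castSucc < l)))) β ?_ ?_ ?_ ?_
  · convert h using 1
    · congr 1
      · refine Finsupp.lhom_ext fun σ r => ?_
        rw [LinearMap.comp_apply, prism_single, map_sum, Finset.sum_comm]
        simp only [boundary_single, LinearMap.sum_apply, LinearMap.smul_apply,
          Finsupp.lmapDomain_apply, Finsupp.mapDomain_single, Finsupp.smul_single, smul_eq_mul,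
          pow_add, mul_assoc]
      · refine Finsupp.lhom_ext fun σ r => ?_
        rw [LinearMap.comp_apply, boundary_single, map_sum]
        simp only [prism_single, LinearMap.sum_apply, LinearMap.smul_apply,
          Finsupp.lmapDomain_apply, Finsupp.mapDomain_single, Finsupp.smul_single, smul_eq_mul,
          pow_add, mul_assoc, mul_left_comm]
    · congr 2
      · funext σ
        ext x
        simp [homotopyEnd, prismMap, stdSimplex.map_id_apply]
      · funext σ
        ext x
        simp [homotopyEnd, prismMap, stdSimplex.map_id_apply, Fin.last_le_iff]
  · intro i
    dsimp only [β]
    congr 1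
    funext σ
    rw [ContinuousMap.comp_assoc, prismMap_comp_faceInclusion]
    congr 1
    refine prismMap_congr (fun l => by simp) fun l => ?_
    simp only [Fin.lt_def, Fin.le_def, val_succAbove, Fin.val_castSucc]
    split_ifs <;> omega
  · intro i
    dsimp only [β]
    congr 1
    funext σ
    rw [ContinuousMap.comp_assoc, prismMap_comp_faceInclusion]
    congr 1
    refine prismMap_congr (fun l => ?_) fun l => ?_
    · simp only [Fin.ext_iff, Function.comp_apply, id, val_succAbove, val_predAbove,
        Fin.val_succ]
      split_ifs <;> omega
    · simp only [Fin.lt_def, Fin.le_def, val_succAbove, Fin.val_castSucc, Fin.val_succ]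
      split_ifs <;> omega
  · intro j i hij
    congr 1
    funext σ
    rw [ContinuousMap.comp_assoc, prismMap_comp_faceInclusion, hH, ContinuousMap.comp_assoc,
      faceInclusion_prodMap_comp_prismMap]
    congr 1
    rw [Fin.le_def, Fin.val_castSucc] at hij
    refine prismMap_congr (fun l => ?_) fun l => ?_
    · simp only [Fin.ext_iff, Function.comp_apply, val_succAbove, val_predAbove,
        Fin.val_succ, Fin.val_castSucc]
      split_ifs <;> omega
    · simp only [Fin.lt_def, val_succAbove, Fin.val_castSucc, Fin.val_succ]
      split_ifs <;> omega
  · intro j i hij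
    congr 1
    funext σ
    rw [ContinuousMap.comp_assoc, prismMap_comp_faceInclusion, hH, ContinuousMap.comp_assoc,
      faceInclusion_prodMap_comp_prismMap]
    congr 1
    rw [Fin.lt_def, Fin.val_castSucc] at hij
    refine prismMap_congr (fun l => ?_) fun l => ?_
    · simp only [Fin.ext_iff, Function.comp_apply, val_succAbove, val_predAbove,
        Fin.val_succ, Fin.val_castSucc]
      split_ifs <;> omega
    · simp only [Fin.lt_def, val_succAbove, Fin.val_castSucc, Fin.val_succ]
      split_ifs <;> omega

/-- The two ends of a natural homotopy of singular simplices are homologous on cycles. -/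
theorem homotopyEnd_sub_mem_boundaries
    (hH : ∀ n (i : Fin (n + 2)) (σ : C(Simplex (n + 1), X)), H n (σ.comp (faceInclusion n i)) =
      (H (n + 1) σ).comp ((faceInclusion n i).prodMap (ContinuousMap.id ℝ))) {n : ℕ}
    {c : Chain ℝ (n + 1) X} (hc : c ∈ Cycles ℝ n X) :
    Finsupp.mapDomain (homotopyEnd H 1 (n + 1)) c -
      Finsupp.mapDomain (homotopyEnd H 0 (n + 1)) c ∈ Boundaries ℝ n X := by
  have h := LinearMap.congr_fun (boundary_prism H hH n) c
  simp only [LinearMap.add_apply, LinearMap.comp_apply, LinearMap.mem_ker.1 hc, map_zero,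
    add_zero, LinearMap.sub_apply, Finsupp.lmapDomain_apply] at h
  exact ⟨_, h⟩

theorem mapDomain_mem_cycles {n : ℕ} {A : ∀ n, C(Simplex n, X) → C(Simplex n, X)}
    (hA : ∀ n (i : Fin (n + 2)) (σ : C(Simplex (n + 1), X)),
      A n (σ.comp (faceInclusion n i)) = (A (n + 1) σ).comp (faceInclusion n i))
    {c : Chain ℝ (n + 1) X} (hc : c ∈ Cycles ℝ n X) :
    Finsupp.mapDomain (A (n + 1)) c ∈ Cycles ℝ n X := by
  have h : boundary ℝ n X ∘ₗ Finsupp.lmapDomain ℝ ℝ (A (n + 1)) =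
      Finsupp.lmapDomain ℝ ℝ (A n) ∘ₗ boundary ℝ n X := by
    refine Finsupp.lhom_ext fun σ r => ?_
    simp only [LinearMap.comp_apply, Finsupp.lmapDomain_apply, Finsupp.mapDomain_single,
      boundary_single, ← hA]
    rw [← Finsupp.lmapDomain_apply ℝ ℝ, map_sum]
    simp only [Finsupp.lmapDomain_apply, Finsupp.mapDomain_single]
  have h := LinearMap.congr_fun h c
  rw [LinearMap.comp_apply, LinearMap.comp_apply, LinearMap.mem_ker.1 hc, map_zero] at h
  exact h

/-- Simplices with the same image have their coefficients added, so the triangle inequality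
suffices. -/
theorem l1Norm_mapDomain_le {n : ℕ} (f : C(Simplex n, X) → C(Simplex n, X)) (c : Chain ℝ n X) :
    l1Norm (Finsupp.mapDomain f c) ≤ l1Norm c := by
  classical
  have h1 : ∀ (a b : Chain ℝ n X), l1Norm (a + b) ≤ l1Norm a + l1Norm b := by
    intro a b
    unfold l1Norm
    rw [Finsupp.sum_of_support_subset (a + b) (s := a.support ∪ b.support)
        Finsupp.support_add _ (by simp),
      Finsupp.sum_of_support_subset a Finset.subset_union_left _ (by simp),
      Finsupp.sum_of_support_subset b Finset.subset_union_right _ (by simp),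
      ← Finset.sum_add_distrib]
    exact Finset.sum_le_sum fun i _ => abs_add_le _ _
  induction c using Finsupp.induction with
  | zero => simp
  | single_add σ r c hσ hr ih =>
    have h2 : l1Norm (Finsupp.single σ r + c) = |r| + l1Norm c := by
      unfold l1Norm
      rw [Finsupp.sum_add_index_of_disjoint, Finsupp.sum_single_index abs_zero]
      rw [Finsupp.support_single _ hr]
      simpa using hσ
    rw [Finsupp.mapDomain_add, Finsupp.mapDomain_single, h2]
    refine (h1 _ _).trans (add_le_add ?_ ih)
    unfold l1Norm
    rw [Finsupp.sum_single_index abs_zero]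

end Prism

/-! ### Conjugating families of hyperplane sections to affine foliations -/

/-- Truncation of a real number to `[-ε, ε]`. -/
noncomputable def clamp (ε u : ℝ) : ℝ := max (-ε) (min ε u)

theorem clamp_mono (ε : ℝ) : Monotone (clamp ε) := fun _ _ h =>
  max_le_max le_rfl (min_le_min le_rfl h)

theorem continuous_clamp (ε : ℝ) : Continuous (clamp ε) :=
  continuous_const.max (continuous_const.min continuous_id)

theorem clamp_of_abs_le {ε u : ℝ} (h : |u| ≤ ε) : clamp ε u = u := by
  rw [clamp, min_eq_right (abs_le.1 h).2, max_eq_right (abs_le.1 h).1]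

theorem clamp_lt_clamp {ε u v : ℝ} (hu : |u| < ε) (h : v < u) : clamp ε v < clamp ε u := by
  rw [clamp_of_abs_le hu.le, clamp, max_lt_iff]
  exact ⟨(abs_lt.1 hu).1, (min_le_right _ _).trans_lt h⟩

theorem eventually_clamp_eq {ε : ℝ} {w : ℝ → ℝ} (hε : 0 < ε) (hw : Continuous w) {s : ℝ}
    (h : ε < |w s|) : ∀ᶠ t in 𝓝 s, clamp ε (w t) = clamp ε (w s) := by
  rcases lt_abs.1 h with h | h
  · filter_upwards [hw.continuousAt.eventually (lt_mem_nhds h)] with t ht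
    rw [clamp, clamp, min_eq_left h.le, min_eq_left (le_of_lt ht)]
  · have h' : w s < -ε := by linarith
    filter_upwards [hw.continuousAt.eventually (gt_mem_nhds h')] with t ht
    have ht : w t < -ε := ht
    rw [clamp, clamp, min_eq_right (by linarith), min_eq_right (by linarith),
      max_eq_left h'.le, max_eq_left ht.le]

/-- Finitely many strictly decreasing functions, having the same germ whenever they vanish at the
same point, are near their zeros positive multiples of one strictly increasing function. -/
theorem exists_strictMono_germ {ι : Type*} [Fintype ι] (s : ι → ℝ) (w : ι → ℝ → ℝ)
    (hc : ∀ i, Continuous (w i)) (hw : ∀ i, StrictAnti (w i)) (h0 : ∀ i, w i (s i) = 0)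
    (hs : ∀ i j, s i = s j → w i =ᶠ[𝓝 (s i)] w j) :
    ∃ θ : ℝ → ℝ, StrictMono θ ∧ Continuous θ ∧
      ∀ i, ∃ m : ℝ, 0 < m ∧ ∀ᶠ t in 𝓝 (s i), θ (s i) - θ t = m * w i t := by
  classical
  -- With this `ε`, the truncation of `w j` at `±ε` is locally constant near every `s i` different
  -- from `s j`, so it does not disturb the germ there.
  obtain ⟨ε, hε, hεw⟩ : ∃ ε : ℝ, 0 < ε ∧ ∀ i j, s i ≠ s j → ε < |w j (s i)| := by
    have h : ∀ᶠ ε : ℝ in 𝓝[>] 0, 0 < ε ∧ ∀ i j, s i ≠ s j → ε < |w j (s i)| := by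
      refine (eventually_mem_nhdsWithin).and (Filter.eventually_all.2 fun i =>
        Filter.eventually_all.2 fun j => ?_)
      by_cases hij : s i = s j
      · simp [hij]
      · have : 0 < |w j (s i)| := by
          rw [abs_pos, ← h0 j]
          exact fun h => hij ((hw j).injective h)
        filter_upwards [nhdsWithin_le_nhds (gt_mem_nhds this)] with ε h _ using h
    exact h.exists
  -- The sum of the truncated functions stops moving where every `|w i|` is at least `ε`. The
  -- primitive of `ρ` restores strict growth there, while `ρ` vanishes where some `|w i|` is below
  -- `ε / 2`, hence near every `s i`.
  let ρ : ℝ → ℝ := fun t => ∏ i, max 0 (|w i t| - ε / 2)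
  have hρc : Continuous ρ := continuous_finsetProd _ fun i _ =>
    continuous_const.max ((hc i).abs.sub continuous_const)
  have hρ0 : ∀ t, 0 ≤ ρ t := fun t => Finset.prod_nonneg fun i _ => le_max_left _ _
  have hρi : ∀ a b, IntervalIntegrable ρ MeasureTheory.volume a b :=
    fun a b => hρc.intervalIntegrable a b
  let R : ℝ → ℝ := fun t => ∫ τ in (0 : ℝ)..t, ρ τ
  have hR : ∀ a b, R b - R a = ∫ τ in a..b, ρ τ := fun a b =>
    intervalIntegral.integral_interval_sub_left (hρi _ _) (hρi _ _)
  refine ⟨fun t => R t - ∑ i, clamp ε (w i t), ?_, ?_, ?_⟩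
  · intro t t' htt
    have h1 : ∀ i ∈ Finset.univ, clamp ε (w i t') ≤ clamp ε (w i t) := fun i _ =>
      clamp_mono ε ((hw i) htt).le
    have h2 : 0 ≤ R t' - R t := by
      rw [hR]; exact intervalIntegral.integral_nonneg htt.le fun x _ => hρ0 x
    by_cases h : ∃ i, |w i t| < ε
    · obtain ⟨i, hi⟩ := h
      have := Finset.sum_lt_sum h1 ⟨i, Finset.mem_univ i, clamp_lt_clamp hi (hw i htt)⟩
      dsimp only
      linarith
    · push Not at h
      have h3 : 0 < R t' - R t := by
        rw [hR]
        refine intervalIntegral.integral_pos htt hρc.continuousOn (fun x _ => hρ0 x)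
          ⟨t, Set.left_mem_Icc.2 htt.le, Finset.prod_pos fun i _ => lt_max_of_lt_right ?_⟩
        linarith [h i]
      have := Finset.sum_le_sum h1
      dsimp only
      linarith
  · exact (intervalIntegral.continuous_primitive hρi 0).sub
      (continuous_finsetSum _ fun i _ => (continuous_clamp ε).comp (hc i))
  · intro i
    -- Near `s i`, exactly the indices `j` with `s j = s i` contribute, each with the germ of `w i`;
    -- the multiple is their number.
    refine ⟨(Finset.univ.filter fun j => s i = s j).card, ?_, ?_⟩
    · exact_mod_cast Finset.card_pos.2 ⟨i, by simp⟩
    · have hR' : ∀ᶠ t in 𝓝 (s i), R t - R (s i) = 0 := by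
        have : ∀ᶠ t in 𝓝 (s i), ρ t = 0 := by
          have : ∀ᶠ t in 𝓝 (s i), |w i t| < ε / 2 :=
            (hc i).abs.continuousAt.eventually (gt_mem_nhds (by simpa [h0] using hε))
          filter_upwards [this] with t ht
          exact Finset.prod_eq_zero (Finset.mem_univ i) (max_eq_left (by linarith))
        obtain ⟨r, hr, hball⟩ := Metric.eventually_nhds_iff_ball.1 this
        filter_upwards [Metric.ball_mem_nhds _ hr] with t ht
        rw [hR]
        refine intervalIntegral.integral_zero_ae (Filter.Eventually.of_forall fun x hx => ?_)
        refine hball x ?_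
        rw [Real.ball_eq_Ioo] at ht ⊢
        exact (Set.ordConnected_Ioo.uIcc_subset
          (by rw [← Real.ball_eq_Ioo]; exact Metric.mem_ball_self hr) ht)
          (Set.uIoc_subset_uIcc hx)
      have hj : ∀ j, ∀ᶠ t in 𝓝 (s i), clamp ε (w j t) - clamp ε (w j (s i)) =
          if s i = s j then w i t else 0 := by
        intro j
        split_ifs with hij
        · have h1 : ∀ᶠ t in 𝓝 (s i), |w j t| < ε :=
            (hc j).abs.continuousAt.eventually (gt_mem_nhds (by simpa [hij, h0] using hε))
          filter_upwards [h1, hs i j hij] with t ht ht'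
          rw [clamp_of_abs_le ht.le, hij, h0, clamp_of_abs_le (by simpa using hε.le), ht', sub_zero]
        · filter_upwards [eventually_clamp_eq hε (hc j) (hεw i j hij)] with t ht
          rw [ht, sub_self]
      filter_upwards [hR', Filter.eventually_all.2 hj] with t ht htj
      have h3 : ∑ j, (clamp ε (w j t) - clamp ε (w j (s i))) =
          (Finset.univ.filter fun j => s i = s j).card * w i t := by
        rw [Finset.sum_congr rfl fun j _ => htj j, ← Finset.sum_filter, Finset.sum_const,
          nsmul_eq_mul]
      rw [Finset.sum_sub_distrib] at h3
      linarith

/-- After factoring `w i t = c i t * (θ (s i) - θ t)`, the equation defining `f x = t` says that the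
weights `x i * c i t`, normalised to sum to one, have `θ (s i)`-average `θ t`. On the fibre `f = t`
the homeomorphism is this rescaling, and it carries the fibre into a hyperplane section. -/
theorem exists_homeomorph_affine {n : ℕ} (s : Fin (n + 1) → ℝ) (w : Fin (n + 1) → ℝ → ℝ)
    (hc : ∀ i, Continuous (w i)) (hw : ∀ i, StrictAnti (w i)) (h0 : ∀ i, w i (s i) = 0)
    (hs : ∀ i j, s i = s j → w i =ᶠ[𝓝 (s i)] w j) (f : Simplex n → ℝ) (hf : Continuous f)
    (hfw : ∀ x : Simplex n, ∑ i, x i * w i (f x) = 0) :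
    ∃ (φ : Simplex n ≃ₜ Simplex n) (a : (Fin (n + 1) → ℝ) →ᵃ[ℝ] ℝ),
      ∀ x y, f x = f y ↔ a (φ x : Fin (n + 1) → ℝ) = a (φ y : Fin (n + 1) → ℝ) := by
  obtain ⟨θ, hθ, hθc, hm⟩ := exists_strictMono_germ s w hc hw h0 hs
  obtain ⟨c, hcc, hcpos, hcw⟩ : ∃ c : Fin (n + 1) → ℝ → ℝ, (∀ i, Continuous (c i)) ∧
      (∀ i t, 0 < c i t) ∧ ∀ i t, w i t = c i t * (θ (s i) - θ t) := by
    choose m hmpos hm using hm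
    -- The quotient `w i t / (θ (s i) - θ t)` equals `(m i)⁻¹` throughout a punctured neighbourhood
    -- of `s i`, so this value extends it continuously.
    refine ⟨fun i t => if t = s i then (m i)⁻¹ else w i t / (θ (s i) - θ t), ?_, ?_, ?_⟩
    · intro i
      rw [continuous_iff_continuousAt]
      intro t
      by_cases ht : t = s i
      · subst ht
        refine ContinuousAt.congr (f := fun _ => (m i)⁻¹) continuousAt_const ?_
        filter_upwards [hm i] with t ht
        split_ifs with h
        · rfl
        · rw [ht, div_mul_cancel_right₀]
          rw [← h0 i]
          exact fun h' => h ((hw i).injective h')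
      · have : ContinuousAt (fun t => w i t / (θ (s i) - θ t)) t :=
          (hc i).continuousAt.div (continuousAt_const.sub hθc.continuousAt)
            (sub_ne_zero.2 fun h => ht (hθ.injective h).symm)
        refine this.congr ?_
        filter_upwards [isOpen_ne.mem_nhds ht] with t' ht'
        rw [if_neg ht']
    · intro i t
      dsimp only
      split_ifs with h
      · exact inv_pos.2 (hmpos i)
      · rcases lt_or_gt_of_ne h with h | h
        · exact div_pos (by rw [← h0 i]; exact hw i h) (sub_pos.2 (hθ h))
        · exact div_pos_of_neg_of_neg (by rw [← h0 i]; exact hw i h) (sub_neg.2 (hθ h))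
    · intro i t
      dsimp only
      split_ifs with h
      · rw [h, h0, sub_self, mul_zero]
      · rw [div_mul_cancel₀]
        exact sub_ne_zero.2 fun h' => h (hθ.injective h').symm
  have hpos : ∀ (x : Simplex n) (d : Fin (n + 1) → ℝ), (∀ i, 0 < d i) → 0 < ∑ i, x i * d i := by
    intro x d hd
    refine (Finset.sum_nonneg fun i _ => mul_nonneg (x.2.1 i) (hd i).le).lt_of_ne' fun h => ?_
    rw [Finset.sum_eq_zero_iff_of_nonneg fun i _ => mul_nonneg (x.2.1 i) (hd i).le] at h
    have h1 : ∑ i, x i = 0 := Finset.sum_eq_zero fun i hi =>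
      (mul_eq_zero.1 (h i hi)).resolve_right (hd i).ne'
    exact one_ne_zero ((stdSimplex.sum_eq_one x).symm.trans h1)
  -- Rescaling of the barycentric coordinates.
  let scale : Simplex n → {d : Fin (n + 1) → ℝ // ∀ i, 0 < d i} → Simplex n := fun x d =>
    ⟨fun i => x i * d.1 i / ∑ j, x j * d.1 j,
      fun i => div_nonneg (mul_nonneg (x.2.1 i) (d.2 i).le) (hpos x d.1 d.2).le, by
        rw [← Finset.sum_div, div_self (hpos x d.1 d.2).ne']⟩
  have scale_apply : ∀ x d i, scale x d i = x i * d.1 i / ∑ j, x j * d.1 j := fun _ _ _ => rfl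
  have scale_scale : ∀ x d d', (∀ i, d'.1 i * d.1 i = 1) → scale (scale x d) d' = x := by
    intro x d d' hd
    ext i
    have h1 : ∀ i, scale x d i * d'.1 i = x i / ∑ j, x j * d.1 j := by
      intro i
      rw [scale_apply, div_mul_eq_mul_div, mul_assoc, mul_comm (d.1 i), hd, mul_one]
    change scale (scale x d) d' i = x i
    rw [scale_apply, h1, Finset.sum_congr rfl fun j _ => h1 j, ← Finset.sum_div,
      stdSimplex.sum_eq_one, div_div_div_cancel_right₀ (hpos x d.1 d.2).ne', div_one]
  let C : ℝ → {d : Fin (n + 1) → ℝ // ∀ i, 0 < d i} := fun t => ⟨fun i => c i t, fun i => hcpos i t⟩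
  let C' : ℝ → {d : Fin (n + 1) → ℝ // ∀ i, 0 < d i} :=
    fun t => ⟨fun i => (c i t)⁻¹, fun i => inv_pos.2 (hcpos i t)⟩
  let a : (Fin (n + 1) → ℝ) →ᵃ[ℝ] ℝ :=
    (∑ i, θ (s i) • (LinearMap.proj i : (Fin (n + 1) → ℝ) →ₗ[ℝ] ℝ)).toAffineMap
  have a_apply : ∀ y : Fin (n + 1) → ℝ, a y = ∑ i, θ (s i) * y i := by
    intro y; simp [a]
  have hsum : ∀ (x : Simplex n) t, ∑ i, x i * w i t =
      (∑ i, x i * c i t) * (a (scale x (C t) : Fin (n + 1) → ℝ) - θ t) := by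
    intro x t
    have hp := (hpos x (C t).1 (C t).2).ne'
    rw [mul_sub, a_apply, Finset.mul_sum, Finset.sum_mul, ← Finset.sum_sub_distrib]
    refine Finset.sum_congr rfl fun i _ => ?_
    rw [hcw]
    change _ = _ * (_ * (x i * c i t / ∑ j, x j * c j t)) - _
    have hp : (∑ j, x j * c j t) ≠ 0 := hp
    field_simp
  have hfa : ∀ x, a (scale x (C (f x)) : Fin (n + 1) → ℝ) = θ (f x) := by
    intro x
    have h := hsum x (f x)
    rw [hfw] at h
    have hp : (∑ j, x j * c j (f x)) ≠ 0 := (hpos x (C (f x)).1 (C (f x)).2).ne'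
    exact sub_eq_zero.1 ((mul_eq_zero.1 h.symm).resolve_left hp)
  have hfu : ∀ x t, ∑ i, x i * w i t = 0 → f x = t := by
    have : ∀ (x : Simplex n), StrictAnti fun t => ∑ i, x i * w i t := by
      intro x t t' htt
      have := hpos x (fun i => w i t - w i t') fun i => sub_pos.2 (hw i htt)
      simp only [mul_sub, Finset.sum_sub_distrib] at this
      exact sub_pos.1 this
    intro x t h
    exact (this x).injective ((hfw x).trans h.symm)
  let φ : Simplex n → Simplex n := fun x => scale x (C (f x))
  have hφ : Continuous φ := by
    have hx : ∀ i, Continuous fun x : Simplex n => x i := fun i =>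
      (continuous_apply i).comp continuous_subtype_val
    have h1 : ∀ i, Continuous fun x : Simplex n => x i * c i (f x) := fun i =>
      (hx i).mul ((hcc i).comp hf)
    refine Continuous.subtype_mk (continuous_pi fun i => (h1 i).div
      (continuous_finsetSum _ fun j _ => h1 j) fun x => (hpos x (C (f x)).1 (C (f x)).2).ne') _
  have hCC : ∀ t i, (C' t).1 i * (C t).1 i = 1 := fun t i => inv_mul_cancel₀ (hcpos i t).ne'
  have hinj : Function.Injective φ := by
    intro x y hxy
    -- The image remembers `θ (f x)` as its affine value, hence the fibre, and on one fibre the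
    -- rescaling is undone by the inverse factors.
    have h : f x = f y := hθ.injective (by
      rw [← hfa, ← hfa]
      exact congrArg (fun z : Simplex n => a z) hxy)
    rw [← scale_scale x (C (f x)) (C' (f x)) (hCC _),
      ← scale_scale y (C (f y)) (C' (f y)) (hCC _), h]
    congr 1
    rw [← h]
    exact hxy.trans (by rw [h])
  have hsurj : Function.Surjective φ := by
    intro y
    -- The affine value of `y` is an average of the `θ (s i)`, so the intermediate value theorem
    -- finds the fibre that must contain the preimage.
    obtain ⟨t, ht⟩ : ∃ t, θ t = a (y : Fin (n + 1) → ℝ) := by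
      obtain ⟨i, hi⟩ := Finite.exists_min s
      obtain ⟨j, hj⟩ := Finite.exists_max s
      refine mem_range_of_exists_le_of_exists_ge hθc ⟨s i, ?_⟩ ⟨s j, ?_⟩
      · rw [a_apply, ← mul_one (θ (s i)), ← stdSimplex.sum_eq_one y, Finset.mul_sum]
        exact Finset.sum_le_sum fun k _ =>
          mul_le_mul_of_nonneg_right (hθ.monotone (hi k)) (y.2.1 k)
      · rw [a_apply, ← mul_one (θ (s j)), ← stdSimplex.sum_eq_one y, Finset.mul_sum]
        exact Finset.sum_le_sum fun k _ =>
          mul_le_mul_of_nonneg_right (hθ.monotone (hj k)) (y.2.1 k)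
    have h1 : scale (scale y (C' t)) (C t) = y :=
      scale_scale _ _ _ fun i => mul_inv_cancel₀ (hcpos i t).ne'
    have h2 : f (scale y (C' t)) = t := hfu _ _ (by rw [hsum, h1, ht, sub_self, mul_zero])
    exact ⟨scale y (C' t), by change scale _ (C (f _)) = y; rw [h2, h1]⟩
  refine ⟨hφ.homeoOfEquivCompactToT2 (f := Equiv.ofBijective φ ⟨hinj, hsurj⟩), a, fun x y => ?_⟩
  change _ ↔ a (scale x (C (f x)) : Fin (n + 1) → ℝ) = a (scale y (C (f y)) : Fin (n + 1) → ℝ)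
  rw [hfa, hfa, hθ.injective.eq_iff]

/-! ### The common level function of finitely many decreasing functions -/

theorem strictAnti_sum_mul {n : ℕ} {w : Fin (n + 1) → ℝ → ℝ} (hw : ∀ i, StrictAnti (w i))
    (x : Simplex n) : StrictAnti fun t => ∑ i, x i * w i t := by
  intro t t' htt
  refine Finset.sum_lt_sum (fun i _ => mul_le_mul_of_nonneg_left (hw i htt).le (x.2.1 i)) ?_
  by_contra! h
  have h1 : ∑ i, x i = 0 := Finset.sum_eq_zero fun i hi => by
    by_contra hx
    exact (h i hi).not_gt (mul_lt_mul_of_pos_left (hw i htt) ((x.2.1 i).lt_of_ne' hx))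
  exact one_ne_zero ((stdSimplex.sum_eq_one x).symm.trans h1)

/-- For fixed `x` the weighted sum is strictly decreasing in `t` and changes sign between the
smallest and the largest `s i`, so it has a unique zero. -/
theorem exists_level {n : ℕ} (s : Fin (n + 1) → ℝ) (w : Fin (n + 1) → ℝ → ℝ)
    (hc : ∀ i, Continuous (w i)) (hw : ∀ i, StrictAnti (w i)) (h0 : ∀ i, w i (s i) = 0) :
    ∃ f : C(Simplex n, ℝ), ∀ x : Simplex n, ∑ i, x i * w i (f x) = 0 := by
  have hcx : ∀ x : Simplex n, Continuous fun t => ∑ i, x i * w i t := fun x =>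
    continuous_finsetSum _ fun i _ => continuous_const.mul (hc i)
  have hct : ∀ t, Continuous fun x : Simplex n => ∑ i, x i * w i t := fun t =>
    continuous_finsetSum _ fun i _ =>
      ((continuous_apply i).comp continuous_subtype_val).mul continuous_const
  have hex : ∀ x : Simplex n, ∃ t, ∑ i, x i * w i t = 0 := by
    intro x
    obtain ⟨i, hi⟩ := Finite.exists_min s
    obtain ⟨j, hj⟩ := Finite.exists_max s
    refine mem_range_of_exists_le_of_exists_ge (hcx x) ⟨s j, ?_⟩ ⟨s i, ?_⟩
    · refine Finset.sum_nonpos fun l _ => mul_nonpos_of_nonneg_of_nonpos (x.2.1 l) ?_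
      rw [← h0 l]
      exact (hw l).antitone (hj l)
    · refine Finset.sum_nonneg fun l _ => mul_nonneg (x.2.1 l) ?_
      rw [← h0 l]
      exact (hw l).antitone (hi l)
  choose f hf using hex
  refine ⟨⟨f, ?_⟩, hf⟩
  -- By monotonicity, comparing `f x` with `b` amounts to reading the sign of the weighted sum at
  -- `b`, which is continuous in `x`.
  rw [OrderTopology.continuous_iff]
  intro b
  constructor
  · convert (isOpen_Ioi (a := (0 : ℝ))).preimage (hct b) using 1
    ext x
    rw [Set.mem_preimage, Set.mem_preimage, Set.mem_Ioi, Set.mem_Ioi, ← hf x,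
      (strictAnti_sum_mul hw x).lt_iff_gt]
  · convert (isOpen_Iio (a := (0 : ℝ))).preimage (hct b) using 1
    ext x
    rw [Set.mem_preimage, Set.mem_preimage, Set.mem_Iio, Set.mem_Iio, ← hf x,
      (strictAnti_sum_mul hw x).lt_iff_gt]

/-! ### Deck transformations -/

instance (n : ℕ) : ContractibleSpace (Simplex n) :=
  (convex_stdSimplex ℝ (Fin (n + 1))).contractibleSpace
    ⟨_, (Classical.arbitrary (Simplex n)).2⟩

instance (n : ℕ) : LocallyPathConnectedSpace (Simplex n) :=
  (convex_stdSimplex ℝ (Fin (n + 1))).locallyPathConnectedSpace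

/-- The group of deck transformations of a map. -/
def deckGroup {E : Type v} {M : Type u} [TopologicalSpace E] (q : E → M) :
    Subgroup (E ≃ₜ E) where
  carrier := {g | ∀ z, q (g z) = q z}
  mul_mem' := fun ha hb z => (ha _).trans (hb z)
  one_mem' := fun _ => rfl
  inv_mem' := fun {g} hg z => by
    rw [← hg (g⁻¹ z)]
    exact congrArg q (g.apply_symm_apply z)

instance {E : Type v} {M : Type u} [TopologicalSpace E] (q : E → M) :
    MulAction (deckGroup q) E where
  smul g z := (g : E ≃ₜ E) z
  one_smul _ := rfl
  mul_smul _ _ _ := rfl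

instance {E : Type v} {M : Type u} [TopologicalSpace E] (q : E → M) :
    ContinuousConstSMul (deckGroup q) E where
  continuous_const_smul g := (g : E ≃ₜ E).continuous

theorem map_deck_smul {E : Type v} {M : Type u} [TopologicalSpace E] {q : E → M}
    (g : deckGroup q) (z : E) : q (g • z) = q z := g.2 z

section Covering

variable {E : Type v} {M : Type u} [TopologicalSpace E] [TopologicalSpace M] {q : E → M}

theorem deck_eq_of_smul_eq [PreconnectedSpace E] (hq : IsCoveringMap q) {g h : deckGroup q}
    {z : E} (hz : g • z = h • z) : g = h := by
  have := hq.eq_of_comp_eq (g₁ := fun z => g • z) (g₂ := fun z => h • z)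
    (continuous_const_smul g) (continuous_const_smul h)
    (funext fun z => (map_deck_smul g z).trans (map_deck_smul h z).symm) z hz
  exact Subtype.ext (Homeomorph.ext fun z => congrFun this z)

theorem exists_deck_smul_eq [SimplyConnectedSpace E] [LocallyPathConnectedSpace E]
    (hq : IsCoveringMap q) {z z' : E} (h : q z = q z') : ∃ g : deckGroup q, g • z = z' := by
  have key : ∀ z z' : E, q z = q z' → ∃ F : C(E, E), F z = z' ∧ q ∘ F = q := by
    intro z z' h
    obtain ⟨F, hF, -⟩ :=
      hq.existsUnique_continuousMap_lifts (A := E) ⟨q, hq.continuous⟩ z z' h.symm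
    exact ⟨F, hF⟩
  obtain ⟨F, hFz, hF⟩ := key z z' h
  obtain ⟨G, hGz, hG⟩ := key z' z h.symm
  have hFG : F ∘ G = id := hq.eq_of_comp_eq (F.continuous.comp G.continuous) continuous_id
    (by rw [← Function.comp_assoc, hF, hG, Function.comp_id]) z' (by simp [hFz, hGz])
  have hGF : G ∘ F = id := hq.eq_of_comp_eq (G.continuous.comp F.continuous) continuous_id
    (by rw [← Function.comp_assoc, hG, hF, Function.comp_id]) z (by simp [hFz, hGz])
  exact ⟨⟨⟨⟨F, G, congrFun hGF, congrFun hFG⟩, F.continuous, G.continuous⟩, congrFun hF⟩, hFz⟩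

theorem surjective_of_isCoveringMap [Nonempty E] [PreconnectedSpace M] (hq : IsCoveringMap q) :
    Function.Surjective q := by
  have hclopen : IsClopen (Set.range q) := by
    refine ⟨⟨?_⟩, hq.isOpenMap.isOpen_range⟩
    rw [isOpen_iff_mem_nhds]
    intro x hx
    obtain ⟨-, U, hxU, hU, -, H, -⟩ := hq x
    filter_upwards [hU.mem_nhds hxU] with y hy
    rintro ⟨z, rfl⟩
    obtain ⟨e, he⟩ := (H ⟨z, hy⟩).2
    exact hx ⟨e, he⟩
  exact Set.range_eq_univ.1 (hclopen.eq_univ (Set.range_nonempty q))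

theorem exists_lift_simplex [Nonempty E] [PreconnectedSpace M] (hq : IsCoveringMap q) {n : ℕ}
    (σ : C(Simplex n, M)) : ∃ τ : C(Simplex n, E), ∀ x, q (τ x) = σ x := by
  obtain ⟨e, he⟩ := surjective_of_isCoveringMap hq (σ (Classical.arbitrary _))
  obtain ⟨τ, ⟨-, hτ⟩, -⟩ := hq.existsUnique_continuousMap_lifts σ _ e he
  exact ⟨τ, congrFun hτ⟩

theorem exists_deck_smul_lift [SimplyConnectedSpace E] [LocallyPathConnectedSpace E]
    (hq : IsCoveringMap q) {n : ℕ} {τ τ' : C(Simplex n, E)} (h : ∀ x, q (τ x) = q (τ' x)) :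
    ∃ g : deckGroup q, ∀ x, τ' x = g • τ x := by
  obtain ⟨g, hg⟩ := exists_deck_smul_eq hq (h (Classical.arbitrary _))
  refine ⟨g, congrFun (hq.eq_of_comp_eq (g₁ := τ') (g₂ := fun x => g • τ x) τ'.continuous
    (τ.continuous.const_smul g) ?_ (Classical.arbitrary _) hg.symm)⟩
  funext x
  simp [map_deck_smul, h]

/-- A deck transformation is determined by the image of one point, and a fibre is a discrete
subspace of a second countable space. Countability is what the Baire argument for the base height
requires. -/
theorem countable_deckGroup [PreconnectedSpace E] [Nonempty E] [SecondCountableTopology E]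
    (hq : IsCoveringMap q) : Countable (deckGroup q) := by
  let z : E := Classical.arbitrary E
  have hd : DiscreteTopology (q ⁻¹' {q z}) := (hq (q z)).1
  have hcount : Countable (q ⁻¹' {q z}) :=
    TopologicalSpace.separableSpace_iff_countable.1 inferInstance
  refine Function.Injective.countable (f := fun g : deckGroup q =>
    (⟨g • z, map_deck_smul g z⟩ : q ⁻¹' {q z})) fun g h hgh => ?_
  exact deck_eq_of_smul_eq hq (congrArg Subtype.val hgh)

/-- A deck-equivariant labelling of the points of the covering by deck transformations. -/
theorem exists_label [SimplyConnectedSpace E] [LocallyPathConnectedSpace E]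
    (hq : IsCoveringMap q) :
    ∃ lab : E → deckGroup q, ∀ (g : deckGroup q) z, lab (g • z) = g * lab z := by
  -- `Function.invFun q` picks one point in each fibre; the label of `z` is the deck transformation
  -- that carries this point to `z`.
  have h : ∀ z : E, ∃ g : deckGroup q, g • Function.invFun q (q z) = z := fun z =>
    exists_deck_smul_eq hq (Function.invFun_eq ⟨z, rfl⟩)
  choose lab hlab using h
  refine ⟨lab, fun g z => deck_eq_of_smul_eq hq (z := Function.invFun q (q z)) ?_⟩
  rw [mul_smul, hlab]
  conv_lhs => rw [← map_deck_smul g z]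
  exact hlab (g • z)

end Covering

/-! ### The action of the deck transformations on heights -/

/-- The model space `ℝᵏ × ℝ`, foliated by its horizontal slices. -/
abbrev Model (k : ℕ) : Type := EuclideanSpace ℝ (Fin k) × ℝ

section Height

variable {k : ℕ} {M : Type u} {q : Model k → M}

/-- The action of a deck transformation on the height coordinate. -/
def height (g : deckGroup q) (t : ℝ) : ℝ := (g • ((0, t) : Model k)).2

theorem continuous_height (g : deckGroup q) : Continuous (height g) :=
  continuous_snd.comp ((continuous_const_smul g).comp
    (Continuous.prodMk continuous_const continuous_id))

/-- The deck transformations preserve the horizontal foliation. -/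
def PreservesHorizontal (q : Model k → M) : Prop :=
  ∀ (g : deckGroup q) (z : Model k), SameFibersNear (fun y => (g • y).2) Prod.snd z

theorem snd_smul (hP : PreservesHorizontal q) (g : deckGroup q) (z : Model k) :
    (g • z).2 = height g z.2 := by
  -- Along a slice the new height is locally constant, and slices are connected.
  have h : IsLocallyConstant fun y : EuclideanSpace ℝ (Fin k) => (g • ((y, z.2) : Model k)).2 := by
    rw [IsLocallyConstant.iff_eventually_eq]
    intro y
    obtain ⟨U, hU, h⟩ := hP g (y, z.2)
    have hc : Continuous fun y : EuclideanSpace ℝ (Fin k) => ((y, z.2) : Model k) :=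
      Continuous.prodMk continuous_id continuous_const
    filter_upwards [hc.continuousAt.eventually hU] with y' hy'
    exact (h _ hy' _ (mem_of_mem_nhds hU)).2 rfl
  exact h.apply_eq_of_preconnectedSpace z.1 0

theorem height_mul (hP : PreservesHorizontal q) (g h : deckGroup q) (t : ℝ) :
    height (g * h) t = height g (height h t) := by
  change ((g * h) • ((0, t) : Model k)).2 = height g (h • ((0, t) : Model k)).2
  rw [← snd_smul hP, mul_smul]

theorem height_one (t : ℝ) : height (1 : deckGroup q) t = t := by
  change ((1 : deckGroup q) • ((0, t) : Model k)).2 = t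
  rw [one_smul]

theorem height_inv_height (hP : PreservesHorizontal q) (g : deckGroup q) (t : ℝ) :
    height g⁻¹ (height g t) = t := by
  rw [← height_mul hP, inv_mul_cancel, height_one]

theorem height_injective (hP : PreservesHorizontal q) (g : deckGroup q) :
    Function.Injective (height g) :=
  Function.LeftInverse.injective (height_inv_height hP g)

theorem strictAnti_height_of_not (hP : PreservesHorizontal q) {g : deckGroup q}
    (h : ¬StrictMono (height g)) : StrictAnti (height g) :=
  ((continuous_height g).strictMono_of_inj (height_injective hP g)).resolve_left h

open Classical in
/-- The sign of the action of a deck transformation on heights: `1` if it is increasing, `-1` if it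
is decreasing. -/
noncomputable def heightSign (g : deckGroup q) : ℝ := if StrictMono (height g) then 1 else -1

theorem heightSign_of_strictAnti {g : deckGroup q} (h : StrictAnti (height g)) :
    heightSign g = -1 :=
  if_neg fun h' => lt_asymm (h' zero_lt_one) (h zero_lt_one)

theorem heightSign_mul (hP : PreservesHorizontal q) (g h : deckGroup q) :
    heightSign (g * h) = heightSign g * heightSign h := by
  have hgh : height (g * h) = height g ∘ height h := funext (height_mul hP g h)
  by_cases hg : StrictMono (height g) <;> by_cases hh : StrictMono (height h)
  · rw [heightSign, heightSign, heightSign, if_pos hg, if_pos hh, if_pos (hgh ▸ hg.comp hh),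
      one_mul]
  · have hh' := strictAnti_height_of_not hP hh
    rw [heightSign_of_strictAnti hh', heightSign_of_strictAnti (hgh ▸ hg.comp_strictAnti hh'),
      heightSign, if_pos hg, one_mul]
  · have hg' := strictAnti_height_of_not hP hg
    rw [heightSign_of_strictAnti hg', heightSign_of_strictAnti (hgh ▸ hg'.comp_strictMono hh),
      heightSign, if_pos hh, mul_one]
  · have hg' := strictAnti_height_of_not hP hg
    have hh' := strictAnti_height_of_not hP hh
    rw [heightSign_of_strictAnti hg', heightSign_of_strictAnti hh', heightSign,
      if_pos (hgh ▸ hg'.comp hh')]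
    norm_num

theorem heightSign_ne_zero (g : deckGroup q) : heightSign g ≠ 0 := by
  unfold heightSign
  split_ifs <;> norm_num

theorem heightSign_inv (hP : PreservesHorizontal q) (g : deckGroup q) :
    heightSign g⁻¹ = heightSign g := by
  refine mul_right_cancel₀ (heightSign_ne_zero g) ?_
  rw [← heightSign_mul hP, inv_mul_cancel]
  have h1 : StrictMono (height (1 : deckGroup q)) := by
    intro a b h
    rwa [height_one, height_one]
  rw [heightSign, if_pos h1, heightSign]
  split_ifs <;> norm_num

/-- The separating function of the translate by `g` of the height `s₀`: it is positive below
that translate and negative above it. -/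
noncomputable def separator (s₀ : ℝ) (g : deckGroup q) (t : ℝ) : ℝ :=
  heightSign g * (s₀ - height g⁻¹ t)

theorem continuous_separator (s₀ : ℝ) (g : deckGroup q) : Continuous (separator s₀ g) :=
  continuous_const.mul (continuous_const.sub (continuous_height _))

theorem strictAnti_separator (hP : PreservesHorizontal q) (s₀ : ℝ) (g : deckGroup q) :
    StrictAnti (separator s₀ g) := by
  intro t t' htt
  unfold separator
  rw [← heightSign_inv hP]
  by_cases h : StrictMono (height g⁻¹)
  · rw [heightSign, if_pos h]
    linarith [h htt]
  · have h' := strictAnti_height_of_not hP h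
    rw [heightSign_of_strictAnti h']
    linarith [h' htt]

theorem separator_height (hP : PreservesHorizontal q) (s₀ : ℝ) (g : deckGroup q) :
    separator s₀ g (height g s₀) = 0 := by
  rw [separator, height_inv_height hP, sub_self, mul_zero]

/-- The sign in `separator` pays for orientation reversal: the deck transformation by `g` multiplies
all separators by the same factor, so zeros of their weighted sums are moved equivariantly. -/
theorem separator_mul (hP : PreservesHorizontal q) (s₀ : ℝ) (g h : deckGroup q) (t : ℝ) :
    separator s₀ (g * h) (height g t) = heightSign g * separator s₀ h t := by
  rw [separator, separator, mul_inv_rev, height_mul hP, height_inv_height hP, heightSign_mul hP,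
    mul_assoc]

/-- The frontier of each closed fixed-point set is nowhere dense. By Baire some height avoids all of
these countably many frontiers; if it is fixed by `g`, it is then interior to the fixed-point set.
-/
theorem exists_generic_height [Countable (deckGroup q)] :
    ∃ s₀ : ℝ, ∀ g : deckGroup q, height g s₀ = s₀ → ∀ᶠ t in 𝓝 s₀, height g t = t := by
  have hclosed : ∀ g : deckGroup q, IsClosed {t | height g t = t} := fun g =>
    isClosed_eq (continuous_height g) continuous_id
  obtain ⟨s₀, hs₀⟩ := (dense_iInter_of_isOpen
    (f := fun g : deckGroup q => (frontier {t | height g t = t})ᶜ)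
    (fun g => isClosed_frontier.isOpen_compl) fun g => by
      rw [← interior_eq_empty_iff_dense_compl]
      exact interior_frontier (hclosed g)).nonempty
  refine ⟨s₀, fun g hg => ?_⟩
  have h1 := Set.mem_iInter.1 hs₀ g
  rw [(hclosed g).frontier_eq] at h1
  exact mem_interior_iff_mem_nhds.1 (not_not.1 fun h => h1 ⟨hg, h⟩)

theorem separator_eventuallyEq (hP : PreservesHorizontal q) {s₀ : ℝ}
    (hs₀ : ∀ g : deckGroup q, height g s₀ = s₀ → ∀ᶠ t in 𝓝 s₀, height g t = t)
    {g h : deckGroup q} (hgh : height g s₀ = height h s₀) :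
    separator s₀ g =ᶠ[𝓝 (height g s₀)] separator s₀ h := by
  have hfix : height (h⁻¹ * g) s₀ = s₀ := by
    rw [height_mul hP, hgh, height_inv_height hP]
  have hev := hs₀ _ hfix
  -- A decreasing homeomorphism cannot be the identity near `s₀`.
  have hsign : heightSign (h⁻¹ * g) = 1 := by
    by_contra hne
    have hanti : StrictAnti (height (h⁻¹ * g)) :=
      strictAnti_height_of_not hP fun hm => hne (if_pos hm)
    obtain ⟨r, hr, hball⟩ := Metric.eventually_nhds_iff_ball.1 hev
    have h1 : height (h⁻¹ * g) (s₀ + r / 2) = s₀ + r / 2 := hball _ (by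
      rw [Metric.mem_ball, Real.dist_eq, add_sub_cancel_left, abs_of_pos (by positivity)]
      linarith)
    have h2 := hanti (show s₀ < s₀ + r / 2 by linarith)
    linarith
  have hsgn : heightSign g = heightSign h := by
    rw [show g = h * (h⁻¹ * g) by group, heightSign_mul hP, hsign, mul_one]
  have hcont : Filter.Tendsto (height g⁻¹) (𝓝 (height g s₀)) (𝓝 s₀) := by
    have := (continuous_height g⁻¹).tendsto (height g s₀)
    rwa [height_inv_height hP] at this
  filter_upwards [hcont.eventually hev] with t ht
  rw [separator, separator, hsgn]
  congr 2
  rw [← ht, ← height_mul hP]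
  congr 1
  group

end Height

/-! ### Iterated contractions towards translates of a base point -/

section Contract

variable {E : Type v} {M : Type u} [TopologicalSpace E] {q : E → M} (κ : ℝ → E → E)

/-- The composite of the conjugates of the contractions `κ (l i)` by the `g i`, in order. -/
def contract : ∀ {m : ℕ}, (Fin m → deckGroup q) → (Fin m → ℝ) → E → E
  | 0, _, _, z => z
  | _ + 1, g, l, z => contract (fun i => g i.succ) (fun i => l i.succ)
      (g 0 • κ (l 0) ((g 0)⁻¹ • z))

theorem continuous_contract {X : Type*} [TopologicalSpace X] (hκ : Continuous (Function.uncurry κ))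
    {m : ℕ} (g : Fin m → deckGroup q) {l : X → Fin m → ℝ} {z : X → E} (hl : Continuous l)
    (hz : Continuous z) : Continuous fun x => contract κ g (l x) (z x) := by
  induction m generalizing z with
  | zero => exact hz
  | succ m ih =>
    refine ih _ (continuous_pi fun i => (continuous_apply i.succ).comp hl)
      ((continuous_const_smul (g 0)).comp (hκ.comp (Continuous.prodMk
        ((continuous_apply 0).comp hl) ((continuous_const_smul (g 0)⁻¹).comp hz))))

theorem contract_smul (γ : deckGroup q) {m : ℕ} (g : Fin m → deckGroup q) (l : Fin m → ℝ) (z : E) :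
    contract κ (fun i => γ * g i) l (γ • z) = γ • contract κ g l z := by
  induction m generalizing z with
  | zero => rfl
  | succ m ih =>
    rw [contract, contract, ← ih, mul_inv_rev, mul_smul, mul_smul, inv_smul_smul]

theorem contract_zero (hκ : ∀ z, κ 0 z = z) {m : ℕ} (g : Fin m → deckGroup q) (z : E) :
    contract κ g (fun _ => 0) z = z := by
  induction m generalizing z with
  | zero => rfl
  | succ m ih => rw [contract, hκ, smul_inv_smul, ih]

/-- A contraction with parameter `0` is the identity, so its factor can be deleted without changing
the order of the others. This is what makes iterated contractions compatible with faces. -/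
theorem contract_succAbove (hκ : ∀ z, κ 0 z = z) {m : ℕ} (g : Fin (m + 1) → deckGroup q)
    (l : Fin (m + 1) → ℝ) (i : Fin (m + 1)) (hi : l i = 0) (z : E) :
    contract κ g l z =
      contract κ (fun j => g (i.succAbove j)) (fun j => l (i.succAbove j)) z := by
  induction m generalizing z with
  | zero =>
    obtain rfl : i = 0 := Fin.fin_one_eq_zero i
    change g 0 • κ (l 0) ((g 0)⁻¹ • z) = z
    rw [hi, hκ, smul_inv_smul]
  | succ m ih =>
    rw [contract]
    refine Fin.cases (fun hi => ?_) (fun i hi => ?_) i hi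
    · rw [hi, hκ, smul_inv_smul]
      rfl
    · rw [ih _ _ i hi]
      conv_rhs => rw [contract]
      simp only [Fin.succ_succAbove_zero, Fin.succ_succAbove_succ]

/-- The factor with parameter `1` identifies all related points, and the earlier factors preserve
the relation; later ones are applied to equal points. It is used with "same height" for leaf
contractions and with the total relation for radial ones. -/
theorem contract_eq_of_eq_one {r : E → E → Prop} (hr : ∀ (g : deckGroup q) l z z', r z z' →
      r (g • κ l (g⁻¹ • z)) (g • κ l (g⁻¹ • z')))
    (h1 : ∀ (g : deckGroup q) z z', r z z' → κ 1 (g⁻¹ • z) = κ 1 (g⁻¹ • z'))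
    {m : ℕ} (g : Fin m → deckGroup q) (l : Fin m → ℝ) (hl : ∃ i, l i = 1) {z z' : E}
    (hz : r z z') : contract κ g l z = contract κ g l z' := by
  induction m generalizing z z' with
  | zero => exact hl.choose.elim0
  | succ m ih =>
    obtain ⟨i, hi⟩ := hl
    rw [contract, contract]
    revert hi
    refine Fin.cases (fun hi => ?_) (fun i hi => ?_) i
    · rw [hi, h1 _ _ _ hz]
    · exact ih _ _ ⟨i, hi⟩ (hr _ _ _ _ hz)

end Contract

/-! ### Barycentric coordinates rescaled to have maximum one -/

/-- The barycentric coordinates divided by their maximum. -/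
noncomputable def coeff {n : ℕ} (x : Simplex n) (i : Fin (n + 1)) : ℝ :=
  x i / ‖(x : Fin (n + 1) → ℝ)‖

theorem norm_simplex_ne_zero {n : ℕ} (x : Simplex n) : ‖(x : Fin (n + 1) → ℝ)‖ ≠ 0 := by
  rw [norm_ne_zero_iff]
  intro h
  have h1 := stdSimplex.sum_eq_one x
  have h2 : ∀ i, x i = 0 := fun i => congrFun h i
  simp [h2] at h1

theorem continuous_coeff {n : ℕ} : Continuous (coeff (n := n)) :=
  continuous_pi fun i => ((continuous_apply i).comp continuous_subtype_val).div
    continuous_subtype_val.norm norm_simplex_ne_zero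

theorem exists_coeff_eq_one {n : ℕ} (x : Simplex n) : ∃ i, coeff x i = 1 := by
  obtain ⟨i, hi⟩ := Finite.exists_max fun i => x i
  refine ⟨i, ?_⟩
  have h : ‖(x : Fin (n + 1) → ℝ)‖ = x i := by
    refine le_antisymm ((pi_norm_le_iff_of_nonneg (x.2.1 i)).2 fun j => ?_) ?_
    · exact (Real.norm_of_nonneg (x.2.1 j)).trans_le (hi j)
    · rw [← Real.norm_of_nonneg (show 0 ≤ x i from x.2.1 i)]
      exact norm_le_pi_norm (x : Fin (n + 1) → ℝ) i
  rw [coeff, ← h, div_self (norm_simplex_ne_zero x)]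

theorem norm_faceInclusion {n : ℕ} (i : Fin (n + 2)) (x : Simplex n) :
    ‖(faceInclusion n i x : Fin (n + 2) → ℝ)‖ = ‖(x : Fin (n + 1) → ℝ)‖ := by
  have h0 : (faceInclusion n i x : Fin (n + 2) → ℝ) i = 0 := faceInclusion_self i x
  have h1 : ∀ j, (faceInclusion n i x : Fin (n + 2) → ℝ) (i.succAbove j) =
    (x : Fin (n + 1) → ℝ) j := faceInclusion_succAbove i x
  refine le_antisymm ((pi_norm_le_iff_of_nonneg (norm_nonneg _)).2 fun j => ?_)
    ((pi_norm_le_iff_of_nonneg (norm_nonneg _)).2 fun j => ?_)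
  · refine Fin.succAboveCases i ?_ (fun j => ?_) j
    · rw [h0, norm_zero]; exact norm_nonneg _
    · rw [h1]; exact norm_le_pi_norm _ j
  · rw [← h1]; exact norm_le_pi_norm _ _

theorem coeff_faceInclusion_self {n : ℕ} (i : Fin (n + 2)) (x : Simplex n) :
    coeff (faceInclusion n i x) i = 0 := by
  rw [coeff, faceInclusion_self, zero_div]

theorem coeff_faceInclusion_succAbove {n : ℕ} (i : Fin (n + 2)) (x : Simplex n)
    (j : Fin (n + 1)) : coeff (faceInclusion n i x) (i.succAbove j) = coeff x j := by
  rw [coeff, faceInclusion_succAbove, norm_faceInclusion, coeff]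

/-! ### Straight simplices -/

section Straight

variable {k : ℕ} {M : Type u} {q : Model k → M} (hP : PreservesHorizontal q) (s₀ : ℝ)

/-- The height function of the straight simplex whose vertices are the translates by the `g i` of a
base point at height `s₀`. -/
noncomputable def level {n : ℕ} (g : Fin (n + 1) → deckGroup q) : C(Simplex n, ℝ) :=
  (exists_level (fun i => height (g i) s₀) (fun i => separator s₀ (g i))
    (fun _ => continuous_separator _ _) (fun _ => strictAnti_separator hP _ _)
    (fun _ => separator_height hP _ _)).choose

theorem sum_separator_level {n : ℕ} (g : Fin (n + 1) → deckGroup q) (x : Simplex n) :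
    ∑ i, x i * separator s₀ (g i) (level hP s₀ g x) = 0 :=
  (exists_level (fun i => height (g i) s₀) (fun i => separator s₀ (g i))
    (fun _ => continuous_separator _ _) (fun _ => strictAnti_separator hP _ _)
    (fun _ => separator_height hP _ _)).choose_spec x

theorem level_eq {n : ℕ} (g : Fin (n + 1) → deckGroup q) (x : Simplex n) {t : ℝ}
    (h : ∑ i, x i * separator s₀ (g i) t = 0) : level hP s₀ g x = t :=
  (strictAnti_sum_mul (fun i => strictAnti_separator hP s₀ (g i)) x).injective
    ((sum_separator_level hP s₀ g x).trans h.symm)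

/-- All separators acquire the common factor `heightSign γ`, which does not affect where the
weighted sum vanishes. -/
theorem level_mul (γ : deckGroup q) {n : ℕ} (g : Fin (n + 1) → deckGroup q) (x : Simplex n) :
    level hP s₀ (fun i => γ * g i) x = height γ (level hP s₀ g x) := by
  refine level_eq hP s₀ _ x ?_
  simp only [separator_mul hP, mul_left_comm _ (heightSign γ)]
  rw [← Finset.mul_sum, sum_separator_level, mul_zero]

theorem level_faceInclusion {n : ℕ} (g : Fin (n + 2) → deckGroup q) (i : Fin (n + 2))
    (x : Simplex n) :
    level hP s₀ g (faceInclusion n i x) = level hP s₀ (fun j => g (i.succAbove j)) x := by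
  refine level_eq hP s₀ _ _ ?_
  rw [Fin.sum_univ_succAbove _ i, faceInclusion_self, zero_mul, zero_add]
  simp only [faceInclusion_succAbove]
  exact sum_separator_level hP s₀ (fun j => g (i.succAbove j)) x

/-- The contraction of each horizontal slice to its centre. -/
noncomputable def leafContraction (l : ℝ) (z : Model k) : Model k := ((1 - l) • z.1, z.2)

theorem continuous_leafContraction :
    Continuous (Function.uncurry (leafContraction (k := k))) := by
  unfold leafContraction Function.uncurry
  fun_prop

theorem leafContraction_zero (z : Model k) : leafContraction 0 z = z := by
  simp [leafContraction]

theorem snd_contract_leafContraction {m : ℕ} (g : Fin m → deckGroup q) (l : Fin m → ℝ)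
    (hP : PreservesHorizontal q) (z : Model k) : (contract leafContraction g l z).2 = z.2 := by
  induction m generalizing z with
  | zero => rfl
  | succ m ih =>
    rw [contract, ih, snd_smul hP]
    change height (g 0) ((g 0)⁻¹ • z).2 = _
    rw [snd_smul hP, ← height_mul hP, mul_inv_cancel, height_one]

theorem contract_leafContraction_congr (hP : PreservesHorizontal q) {m : ℕ}
    (g : Fin m → deckGroup q) (l : Fin m → ℝ) (hl : ∃ i, l i = 1) {z z' : Model k}
    (hz : z.2 = z'.2) : contract leafContraction g l z = contract leafContraction g l z' := by
  have h1 : ∀ (g : deckGroup q) (z z' : Model k), z.2 = z'.2 → (g • z).2 = (g • z').2 := by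
    intro g z z' h
    rw [snd_smul hP, snd_smul hP, h]
  refine contract_eq_of_eq_one leafContraction (r := fun z z' => z.2 = z'.2) ?_ ?_ g l hl hz
  · exact fun g l z z' h => h1 _ _ _ (h1 _ _ _ h)
  · intro g z z' h
    refine Prod.ext ?_ (h1 _ _ _ h)
    simp [leafContraction]

/-- The straight simplex whose vertices are the translates by the `g i` of a base point at
height `s₀`. -/
noncomputable def straight {n : ℕ} (g : Fin (n + 1) → deckGroup q) : C(Simplex n, Model k) where
  toFun x := contract leafContraction g (coeff x) (0, level hP s₀ g x)
  continuous_toFun := continuous_contract _ continuous_leafContraction _ continuous_coeff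
    (continuous_const.prodMk (level hP s₀ g).continuous)

theorem snd_straight {n : ℕ} (g : Fin (n + 1) → deckGroup q) (x : Simplex n) :
    (straight hP s₀ g x).2 = level hP s₀ g x :=
  snd_contract_leafContraction g _ hP _

theorem straight_mul (γ : deckGroup q) {n : ℕ} (g : Fin (n + 1) → deckGroup q) (x : Simplex n) :
    straight hP s₀ (fun i => γ * g i) x = γ • straight hP s₀ g x := by
  change contract _ _ _ _ = γ • contract _ _ _ _
  rw [← contract_smul]
  -- The starting points on the two sides lie in the same slice but need not be equal. Since some
  -- rescaled coordinate is `1`, the iterated contraction sees only the slice.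
  refine contract_leafContraction_congr hP _ _ (exists_coeff_eq_one x) ?_
  rw [snd_smul hP, level_mul]

theorem straight_faceInclusion {n : ℕ} (g : Fin (n + 2) → deckGroup q) (i : Fin (n + 2))
    (x : Simplex n) :
    straight hP s₀ g (faceInclusion n i x) = straight hP s₀ (fun j => g (i.succAbove j)) x := by
  change contract _ _ _ _ = contract _ _ _ _
  rw [contract_succAbove _ leafContraction_zero _ _ i (coeff_faceInclusion_self i x),
    level_faceInclusion]
  simp only [coeff_faceInclusion_succAbove]

end Straight

/-! ### Operations on singular simplices through their lifts -/

section Descend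

variable {E : Type v} {M : Type u} [TopologicalSpace E] {q : E → M}

/-- The labels of the vertices of a singular simplex. -/
noncomputable def vertexLabels (lab : E → deckGroup q) {n : ℕ} (τ : C(Simplex n, E))
    (i : Fin (n + 1)) : deckGroup q :=
  lab (τ (stdSimplex.vertex i))

theorem vertexLabels_faceInclusion (lab : E → deckGroup q) {n : ℕ} (τ : C(Simplex (n + 1), E))
    (i : Fin (n + 2)) :
    vertexLabels lab (τ.comp (faceInclusion n i)) =
      fun j => vertexLabels lab τ (i.succAbove j) := by
  funext j
  exact congrArg (fun x => lab (τ x)) (stdSimplex.map_vertex i.succAbove j)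

/-- The homotopy from `A τ` to an iterated contraction towards the vertices of `τ`. -/
noncomputable def contractHomotopy (κ : ℝ → E → E) (hκ : Continuous (Function.uncurry κ))
    (lab : E → deckGroup q) (A : ∀ n, C(Simplex n, E) → C(Simplex n, E)) (n : ℕ)
    (τ : C(Simplex n, E)) : C(Simplex n × ℝ, E) where
  toFun p := contract κ (vertexLabels lab τ) (fun i => p.2 * coeff p.1 i) (A n τ p.1)
  continuous_toFun := by
    refine continuous_contract κ hκ _ (continuous_pi fun i => continuous_snd.mul
      ((continuous_apply i).comp (continuous_coeff.comp continuous_fst)))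
      ((A n τ).continuous.comp continuous_fst)

theorem contractHomotopy_smul {κ : ℝ → E → E} (hκ : Continuous (Function.uncurry κ))
    {lab : E → deckGroup q} (hlab : ∀ (g : deckGroup q) z, lab (g • z) = g * lab z)
    {A : ∀ n, C(Simplex n, E) → C(Simplex n, E)}
    (hA : ∀ n (g : deckGroup q) (τ τ' : C(Simplex n, E)), (∀ x, τ' x = g • τ x) →
      ∀ x, A n τ' x = g • A n τ x) {n : ℕ} {g : deckGroup q} {τ τ' : C(Simplex n, E)}
    (h : ∀ x, τ' x = g • τ x) (p : Simplex n × ℝ) :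
    contractHomotopy κ hκ lab A n τ' p = g • contractHomotopy κ hκ lab A n τ p := by
  change contract _ _ _ _ = g • contract _ _ _ _
  rw [← contract_smul, hA n g τ τ' h]
  congr 1
  funext i
  rw [vertexLabels, h, hlab, vertexLabels]

theorem contractHomotopy_faceInclusion {κ : ℝ → E → E} (hκ : Continuous (Function.uncurry κ))
    (hκ0 : ∀ z, κ 0 z = z) {lab : E → deckGroup q}
    {A : ∀ n, C(Simplex n, E) → C(Simplex n, E)}
    (hA : ∀ n (i : Fin (n + 2)) (τ : C(Simplex (n + 1), E)),
      A n (τ.comp (faceInclusion n i)) = (A (n + 1) τ).comp (faceInclusion n i))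
    {n : ℕ} (i : Fin (n + 2)) (τ : C(Simplex (n + 1), E)) (p : Simplex n × ℝ) :
    contractHomotopy κ hκ lab A n (τ.comp (faceInclusion n i)) p =
      contractHomotopy κ hκ lab A (n + 1) τ (faceInclusion n i p.1, p.2) := by
  change contract _ _ _ _ = contract _ _ _ _
  dsimp only
  rw [contract_succAbove κ hκ0 _ _ i (by rw [coeff_faceInclusion_self, mul_zero]), hA,
    vertexLabels_faceInclusion]
  simp only [coeff_faceInclusion_succAbove]
  rfl

variable [TopologicalSpace M]

/-- A lift of a singular simplex to a covering. -/
noncomputable def liftSimplex [Nonempty E] [PreconnectedSpace M] (hq : IsCoveringMap q) {n : ℕ}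
    (σ : C(Simplex n, M)) : C(Simplex n, E) := (exists_lift_simplex hq σ).choose

theorem map_liftSimplex [Nonempty E] [PreconnectedSpace M] (hq : IsCoveringMap q) {n : ℕ}
    (σ : C(Simplex n, M)) (x : Simplex n) : q (liftSimplex hq σ x) = σ x :=
  (exists_lift_simplex hq σ).choose_spec x

/-- The homotopy of singular simplices of the base induced by one of lifted simplices. -/
noncomputable def descend [Nonempty E] [PreconnectedSpace M] (hq : IsCoveringMap q)
    (H : ∀ n, C(Simplex n, E) → C(Simplex n × ℝ, E)) (n : ℕ) (σ : C(Simplex n, M)) :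
    C(Simplex n × ℝ, M) :=
  (⟨q, hq.continuous⟩ : C(E, M)).comp (H n (liftSimplex hq σ))

/-- The chosen lift of a face and the face of the chosen lift differ by a deck transformation, which
equivariance of `H` makes invisible after projection. -/
theorem descend_faceInclusion [SimplyConnectedSpace E] [LocallyPathConnectedSpace E]
    [PreconnectedSpace M] (hq : IsCoveringMap q)
    {H : ∀ n, C(Simplex n, E) → C(Simplex n × ℝ, E)}
    (hH : ∀ n (g : deckGroup q) (τ τ' : C(Simplex n, E)), (∀ x, τ' x = g • τ x) →
      ∀ p, H n τ' p = g • H n τ p)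
    (hHf : ∀ n (i : Fin (n + 2)) (τ : C(Simplex (n + 1), E)) p,
      H n (τ.comp (faceInclusion n i)) p = H (n + 1) τ (faceInclusion n i p.1, p.2))
    (n : ℕ) (i : Fin (n + 2)) (σ : C(Simplex (n + 1), M)) :
    descend hq H n (σ.comp (faceInclusion n i)) =
      (descend hq H (n + 1) σ).comp ((faceInclusion n i).prodMap (ContinuousMap.id ℝ)) := by
  obtain ⟨g, hg⟩ := exists_deck_smul_lift hq
    (τ := (liftSimplex hq σ).comp (faceInclusion n i))
    (τ' := liftSimplex hq (σ.comp (faceInclusion n i))) fun x => by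
      rw [map_liftSimplex hq, ContinuousMap.comp_apply, map_liftSimplex hq,
        ContinuousMap.comp_apply]
  ext1 p
  change q (H n _ p) = q (H (n + 1) _ (faceInclusion n i p.1, p.2))
  rw [hH n g _ _ hg, map_deck_smul g, hHf]

end Descend

/-! ### Transversality of straight simplices -/

section SameFibers

variable {X : Type u} {Y : Type v} [TopologicalSpace X] [TopologicalSpace Y] {A B C : Type*}

theorem SameFibersNear.symm {g : X → A} {h : X → B} {x : X} (H : SameFibersNear g h x) :
    SameFibersNear h g x :=
  let ⟨U, hU, hg⟩ := H
  ⟨U, hU, fun y hy z hz => (hg y hy z hz).symm⟩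

theorem SameFibersNear.trans {g : X → A} {h : X → B} {f : X → C} {x : X}
    (H : SameFibersNear g h x) (H' : SameFibersNear h f x) : SameFibersNear g f x :=
  let ⟨U, hU, hg⟩ := H
  let ⟨V, hV, hh⟩ := H'
  ⟨U ∩ V, Filter.inter_mem hU hV, fun y hy z hz =>
    (hg y hy.1 z hz.1).trans (hh y hy.2 z hz.2)⟩

theorem SameFibersNear.comp {g : X → A} {h : X → B} {p : Y → X} {y : Y}
    (H : SameFibersNear g h (p y)) (hp : ContinuousAt p y) :
    SameFibersNear (fun z => g (p z)) (fun z => h (p z)) y :=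
  let ⟨U, hU, hg⟩ := H
  ⟨p ⁻¹' U, hp hU, fun _ hz _ hz' => hg _ hz _ hz'⟩

end SameFibers

section Model

variable {k : ℕ} {M : Type u} [TopologicalSpace M] {q : Model k → M} {F : Foliation k M}

/-- The map `q` pulls the foliation `F` back to the horizontal foliation. -/
def PullsBackToHorizontal (F : Foliation k M) (q : Model k → M) : Prop :=
  ∀ (z : Model k), ∀ e ∈ F.charts, q z ∈ e.source →
    SameFibersNear (fun y => (e (q y)).2) Prod.snd z

theorem PullsBackToHorizontal.preservesHorizontal (h : PullsBackToHorizontal F q) :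
    PreservesHorizontal q := by
  intro g z
  obtain ⟨e, he, hz⟩ := F.cover (q z)
  have h1 := (h (g • z) e he (by rwa [map_deck_smul g])).comp
    (p := fun y => g • y) (continuous_const_smul g).continuousAt
  simp only [map_deck_smul] at h1
  exact h1.symm.trans (h z e he hz)

/-- The induced foliation is given by the fibres of `level`; genericity of `s₀` supplies the
equality of germs needed to make these fibres affine. -/
theorem PullsBackToHorizontal.isTransverse_comp_straight (h : PullsBackToHorizontal F q)
    (hq : Continuous q) {s₀ : ℝ}
    (hs₀ : ∀ g : deckGroup q, height g s₀ = s₀ → ∀ᶠ t in 𝓝 s₀, height g t = t)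
    {n : ℕ} (g : Fin (n + 1) → deckGroup q) :
    F.IsTransverse ((⟨q, hq⟩ : C(Model k, M)).comp
      (straight h.preservesHorizontal s₀ g)) := by
  have hP := h.preservesHorizontal
  obtain ⟨φ, a, ha⟩ := exists_homeomorph_affine (fun i => height (g i) s₀)
    (fun i => separator s₀ (g i)) (fun _ => continuous_separator _ _)
    (fun _ => strictAnti_separator hP _ _) (fun _ => separator_height hP _ _)
    (fun i j hij => separator_eventuallyEq hP hs₀ hij) _ (level hP s₀ g).continuous
    (sum_separator_level hP s₀ g)
  refine ⟨φ, a, fun t e he ht => ?_⟩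
  have h1 := (h (straight hP s₀ g t) e he ht).comp (straight hP s₀ g).continuous.continuousAt
  refine h1.trans ⟨Set.univ, Filter.univ_mem, fun y _ z _ => ?_⟩
  simp only [snd_straight]
  exact ha y z

/-! ### Straightening preserves homology classes -/

/-- The radial contraction of the model space. -/
noncomputable def radialContraction (l : ℝ) (z : Model k) : Model k := (1 - l) • z

theorem continuous_radialContraction :
    Continuous (Function.uncurry (radialContraction (k := k))) := by
  unfold radialContraction Function.uncurry
  fun_prop

theorem radialContraction_zero (z : Model k) : radialContraction 0 z = z := by
  simp [radialContraction]

theorem PullsBackToHorizontal.exists_transverse_cycle [PreconnectedSpace M]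
    (h : PullsBackToHorizontal F q) (hq : IsCoveringMap q) {n : ℕ} (c : Cycles ℝ n M) :
    ∃ c' : Cycles ℝ n M, homologyClass c' = homologyClass c ∧
      (∀ σ ∈ (c' : Chain ℝ (n + 1) M).support, F.IsTransverse σ) ∧
      l1Norm (c' : Chain ℝ (n + 1) M) ≤ l1Norm (c : Chain ℝ (n + 1) M) := by
  classical
  have hP := h.preservesHorizontal
  have : Countable (deckGroup q) := countable_deckGroup hq
  obtain ⟨s₀, hs₀⟩ := exists_generic_height (q := q)
  obtain ⟨lab, hlab⟩ := exists_label hq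
  -- `A` straightens lifted simplices and `B` below leaves them alone; both are equivariant and
  -- compatible with faces, so the same contraction homotopy applies to each.
  let A : ∀ n, C(Simplex n, Model k) → C(Simplex n, Model k) := fun n τ =>
    straight hP s₀ (vertexLabels lab τ)
  have hA : ∀ n (g : deckGroup q) (τ τ' : C(Simplex n, Model k)), (∀ x, τ' x = g • τ x) →
      ∀ x, A n τ' x = g • A n τ x := by
    intro n g τ τ' hτ x
    rw [← straight_mul]
    refine congrArg (fun g' => straight hP s₀ g' x) (funext fun i => ?_)
    rw [vertexLabels, hτ, hlab, vertexLabels]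
  have hAf : ∀ n (i : Fin (n + 2)) (τ : C(Simplex (n + 1), Model k)),
      A n (τ.comp (faceInclusion n i)) = (A (n + 1) τ).comp (faceInclusion n i) := by
    intro n i τ
    ext1 x
    rw [ContinuousMap.comp_apply, straight_faceInclusion, ← vertexLabels_faceInclusion]
  let B : ∀ n, C(Simplex n, Model k) → C(Simplex n, Model k) := fun n τ => τ
  have hκ := continuous_radialContraction (k := k)
  let HA := descend hq (contractHomotopy radialContraction hκ lab A)
  let HB := descend hq (contractHomotopy radialContraction hκ lab B)
  have hHA := descend_faceInclusion hq
    (fun n g τ τ' hτ p => contractHomotopy_smul hκ hlab hA hτ p)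
    (fun n i τ p => contractHomotopy_faceInclusion hκ radialContraction_zero hAf i τ p)
  have hHB := descend_faceInclusion hq
    (fun n g τ τ' hτ p => contractHomotopy_smul hκ hlab (A := B) (fun _ _ _ _ h => h) hτ p)
    (fun n i τ p => contractHomotopy_faceInclusion hκ radialContraction_zero (A := B)
      (fun _ _ _ => rfl) i τ p)
  have hA0 : ∀ n (σ : C(Simplex n, M)), homotopyEnd HA 0 n σ =
      (⟨q, hq.continuous⟩ : C(Model k, M)).comp
        (straight hP s₀ (vertexLabels lab (liftSimplex hq σ))) := by
    intro n σ
    ext1 x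
    change q (contract _ _ (fun i => 0 * coeff x i) _) = q _
    simp only [zero_mul, contract_zero _ radialContraction_zero]
    rfl
  have hB0 : ∀ n (σ : C(Simplex n, M)), homotopyEnd HB 0 n σ = σ := by
    intro n σ
    ext1 x
    change q (contract _ _ (fun i => 0 * coeff x i) _) = _
    simp only [zero_mul, contract_zero _ radialContraction_zero]
    exact map_liftSimplex hq σ x
  -- At time `1` some radial contraction has parameter `1` and collapses the whole model space, so
  -- the end depends on the vertex labels and barycentric coordinates alone, not on `A` or `B`.
  have hAB : ∀ n, homotopyEnd HA 1 n = homotopyEnd HB 1 n := by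
    intro n
    funext σ
    ext1 x
    change q (contract _ _ (fun i => 1 * coeff x i) _) =
      q (contract _ _ (fun i => 1 * coeff x i) _)
    simp only [one_mul]
    rw [contract_eq_of_eq_one radialContraction (r := fun _ _ => True)
      (fun _ _ _ _ _ => trivial) (fun _ _ _ _ => by simp [radialContraction]) _ _
      (exists_coeff_eq_one x) trivial]
  have hcyc : Finsupp.mapDomain (homotopyEnd HA 0 (n + 1)) (c : Chain ℝ (n + 1) M) ∈
      Cycles ℝ n M := by
    refine mapDomain_mem_cycles (A := homotopyEnd HA 0) (fun m i σ => ?_) c.2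
    exact congrArg (fun K : C(Simplex m × ℝ, M) => K.comp
      ((ContinuousMap.id _).prodMk (ContinuousMap.const _ 0))) (hHA m i σ)
  refine ⟨⟨_, hcyc⟩, ?_, ?_, l1Norm_mapDomain_le _ _⟩
  · refine Subtype.ext ((Submodule.Quotient.eq _).2 ?_)
    have h1 := homotopyEnd_sub_mem_boundaries HA hHA c.2
    have h2 := homotopyEnd_sub_mem_boundaries HB hHB c.2
    have h3 : Finsupp.mapDomain (homotopyEnd HB 0 (n + 1)) (c : Chain ℝ (n + 1) M) = c := by
      rw [show homotopyEnd HB 0 (n + 1) = id from funext (hB0 _), Finsupp.mapDomain_id]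
    rw [hAB] at h1
    rw [h3] at h2
    have h4 := (Boundaries ℝ n M).sub_mem h2 h1
    rwa [sub_sub_sub_cancel_left] at h4
  · intro σ hσ
    obtain ⟨σ', -, rfl⟩ := Finset.mem_image.1 (Finsupp.mapDomain_support hσ)
    rw [hA0]
    exact h.isTransverse_comp_straight hq.continuous hs₀ _

end Model

/-! ### Comparison of the two norms -/

theorem gromovNorm_eq_foliatedGromovNorm {k : ℕ} {M : Type u} [TopologicalSpace M]
    [PreconnectedSpace M] {F : Foliation k M} {q : Model k → M} (hq : IsCoveringMap q)
    (h : PullsBackToHorizontal F q) {n : ℕ} (μ : Homology ℝ n M) :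
    gromovNorm μ = foliatedGromovNorm F μ := by
  refine le_antisymm (le_iInf₂ fun c hc => le_iInf fun _ => iInf₂_le c hc)
    (le_iInf₂ fun c hc => ?_)
  obtain ⟨c', hc', htr, hnorm⟩ := h.exists_transverse_cycle hq c
  exact (iInf₂_le_of_le c' (hc'.trans hc) (iInf_le _ htr)).trans (ENNReal.ofReal_le_ofReal hnorm)

theorem pullsBackToHorizontal_of_conjugate {k : ℕ} {M : Type u} {N : Type v}
    [TopologicalSpace M] [TopologicalSpace N] {F : Foliation k M} {p : N → M}
    (hp : IsLocalHomeomorph p) (Φ : N ≃ₜ Model k)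
    (hΦ : ∀ x : N, ∀ e ∈ (F.pullback hp).charts, ∀ e' ∈ (Foliation.horizontal k).charts,
      x ∈ e.source → Φ x ∈ e'.source →
        SameFibersNear (fun y => (e y).2) (fun y => (e' (Φ y)).2) x) :
    PullsBackToHorizontal F (p ∘ Φ.symm) := by
  intro z e he hz
  obtain ⟨s, hs, rfl⟩ := hp (Φ.symm z)
  -- A local inverse branch of `p` followed by `e` is a chart of the pulled-back foliation, so the
  -- conjugacy can be tested on it and then transported by `Φ.symm`.
  have h1 := hΦ (Φ.symm z) (s.trans e) ⟨e, he, s, fun _ _ => rfl, rfl⟩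
    (OpenPartialHomeomorph.refl _) rfl
    (by rw [OpenPartialHomeomorph.trans_source]; exact ⟨hs, hz⟩) (Set.mem_univ _)
  have h2 := h1.comp (p := Φ.symm) Φ.symm.continuous.continuousAt
  simpa using h2

end FoliatedGromov

theorem theorem2p2p10
    {k : ℕ}
    {M : Type*} [TopologicalSpace M] [T2Space M] [CompactSpace M] [ConnectedSpace M]
    {N : Type*} [TopologicalSpace N] [SimplyConnectedSpace N]
    {p : N → M} (hp : IsCoveringMap p)
    (F : FoliatedGromov.Foliation k M)
    (hF : (F.pullback hp.isLocalHomeomorph).Conjugate (FoliatedGromov.Foliation.horizontal k))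
    (μ : FoliatedGromov.Homology ℝ k M) (hμ : FoliatedGromov.IsFundamentalClass μ) :
    FoliatedGromov.gromovNorm μ = FoliatedGromov.foliatedGromovNorm F μ := by
  obtain ⟨Φ, hΦ⟩ := hF
  exact FoliatedGromov.gromovNorm_eq_foliatedGromovNorm (hp.comp_homeomorph Φ.symm)
    (FoliatedGromov.pullsBackToHorizontal_of_conjugate hp.isLocalHomeomorph Φ hΦ) μ
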